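/- **Setting.** Graphs are directed, possibly with self-loops, on the vertices $1,\dots,n$. The adjacency matrix $S$ of $G=(\{1,\dots,n\},E)$ has $s_{ij}=1$ if $(j,i)\in E$ and $s_{ij}=0$ otherwise. A node $i$ is a *sink* if there is no $j\ne i$ with $(i,j)\in E$, and *isolated* if no edge joins it to a different node. Let $G_{\mathcal P},G_{\mathcal K},G_{\mathcal C}$ (plant, control and design graph) be given, where $G_{\mathcal K}$ and $G_{\mathcal C}$ contain all self-loops, and let $\epsilon_b>0$. A *plant* is a tuple $P=(A,B,D,x_0,w_0)$ where $A\in\mathbb R^{n\times n}$ has $a_{ij}=0$ whenever $(s_{\mathcal P})_{ij}=0$, $B\in\mathbb R^{n\times n}$ is diagonal with smallest singular value at least $\epsilon_b$, $D\in\mathbb R^{n\times n}$ is diagonal, and $x_0,w_0\in\mathbb R^n$. Let $\mathcal P$ be the set of plants. Its dynamics are $$x(k+1)=Ax(k)+B(u(k)+w(k)),\quad x(0)=x_0,\qquad w(k+1)=Dw(k),\quad w(0)=w_0 .$$ The set $\mathcal K$ of *controllers* consists of the $n\times n$ matrices $K$ of proper real rational functions with $k_{ij}=0$ whenever $(s_{\mathcal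 K})_{ij}=0$; the controller starts from zero controller state, i.e. $u(k)=\sum_{m=0}^{k}H_{k-m}x(m)$ where $K(z)=\sum_{k\ge0}H_kz^{-k}$ is the expansion at infinity. The cost is $$J_P(K)=\sum_{k=0}^\infty\big[x(k)^Tx(k)+(u(k)+w(k))^T(u(k)+w(k))\big]\in[0,\infty].$$ Let $\mathcal C$ be the set of *control design strategies*, i.e. maps $\Gamma$ assigning to every $(A,B,D)$ (as above) a controller $\Gamma(A,B,D)\in\mathcal K$ such that, for each $i$, the $i$-th row of $\Gamma(A,B,D)$ depends only on the $j$-th row of $A$, on $b_{jj}$ and on $d_{jj}$, for the $j$ with $(j,i)\in E_{\mathcal C}$. The *competitive ratio* of $\Gamma$ is $$r_{\mathcal P}(\Gamma)=\sup_{P=(A,B,D,x_0,w_0)\in\mathcal P}\frac{J_P(\Gamma(A,B,D))}{J_P^*},\qquad J^*_P=\inf_{K\in\mathcal K}J_P(K),\qquad \tfrac00:=1$$ (so $J_P^*=J_P(K^*(P))$ if an optimal controller $K^*(P)\in\mathcal K$ exists). Let $r^\circ_{\mathcal P}(\Gamma)$ be the version in which the optimal controller may depend on $(A,B,D)$ only: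 the supremum of $J_P(\Gamma(A,B,D))/J_P(K^\circ)$ over all plants $P=(A,B,D,x_0,w_0)$ and all $K^\circ\in\mathcal K$ such that $J_{(A,B,D,0,w)}(K^\circ)\le J_{(A,B,D,0,w)}(K)$ for all $K\in\mathcal K$ and all $w\in\mathbb R^n$. A strategy $\Gamma$ *dominates* $\Gamma'$ if $J_P(\Gamma(A,B,D))\le J_P(\Gamma'(A,B,D))$ for all $P\in\mathcal P$, with strict inequality for at least one $P$; $\Gamma'$ is *undominated in* $\mathcal C$ if $\Gamma'\in\mathcal C$ and no $\Gamma\in\mathcal C$ dominates it. Let $(S_{\mathcal P})_{11}$ be the block of $S_{\mathcal P}$ with rows and columns indexed by the nodes that are not sinks of $G_{\mathcal P}$. Let $\Gamma^\Theta(A,B,D)=C_K(zI-A_K)^{-1}B_K+D_K$ with $$A_K=D,\quad B_K=B^{-1}DFA-B^{-1}D^2,\quad C_K=I,\quad D_K=B^{-1}(F-I)A-B^{-1}D,$$ where $F=F(A,B)$ is diagonal, its $i$-th diagonal entry being $0$ if $i$ is not a sink of $G_{\mathcal P}$ and $$f_i(A,B)=\frac{2}{b_{ii}^2+a_{ii}^2+1+\sqrt{(a_{ii}^2+b_{ii}^2)^2+2(b_{ii}^2-a_{ii}^2)+1}}$$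 if $i$ is a sink. **Theorem (Plant Graphs with Sinks).** Assume that $G_{\mathcal P}$ has no isolated node and at least one sink, that $G_{\mathcal C}$ is totally disconnected (it has no edge between different nodes), and that $G_{\mathcal K}\supseteq G_{\mathcal P}$. Then: (a) If $(S_{\mathcal P})_{11}$ is not diagonal, then every $\Gamma\in\mathcal C$ satisfies $$r_{\mathcal P}(\Gamma)\ \ge\ \frac{2\epsilon_b^2+1+\sqrt{4\epsilon_b^2+1}}{2\epsilon_b^2},$$ and the same lower bound holds for $r^\circ_{\mathcal P}(\Gamma)$. (b) The strategy $\Gamma^\Theta$ is undominated in $\mathcal C$. -/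

import Mathlib

namespace LimitedModel

noncomputable section

/-! ### Graphs

Directed graphs, possibly with self-loops, on the vertices `Fin n` are `Digraph (Fin n)`;
`G.Adj j i` says that `(j, i)` is an edge, and `G ≤ G'` says that `G'` is a supergraph of `G`. -/

/-- `i` is a sink: there is no edge from `i` to a different node. -/
def IsSink {n : ℕ} (G : Digraph (Fin n)) (i : Fin n) : Prop :=
  ∀ j, j ≠ i → ¬ G.Adj i j

/-- `i` is isolated: there is no edge between `i` and a different node. -/
def IsIsolated {n : ℕ} (G : Digraph (Fin n)) (i : Fin n) : Prop :=
  ∀ j, j ≠ i → ¬ G.Adj i j ∧ ¬ G.Adj j i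

open Classical in
/-- The adjacency matrix, with `s i j = 1` if `(j, i)` is an edge and `s i j = 0` otherwise. -/
def adjacency {n : ℕ} (G : Digraph (Fin n)) : Matrix (Fin n) (Fin n) ℝ :=
  Matrix.of fun i j => if G.Adj j i then 1 else 0

/-- The block of the adjacency matrix on the nodes that are not sinks. -/
def nonsinkBlock {n : ℕ} (G : Digraph (Fin n)) :
    Matrix {i : Fin n // ¬ IsSink G i} {i : Fin n // ¬ IsSink G i} ℝ :=
  (adjacency G).submatrix Subtype.val Subtype.val

/-- No edge joins two different nodes. -/
def TotallyDisconnectedGraph {n : ℕ} (G : Digraph (Fin n)) : Prop :=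
  ∀ i j, i ≠ j → ¬ G.Adj i j

/-- Every node carries a self-loop. -/
def HasAllLoops {n : ℕ} (G : Digraph (Fin n)) : Prop :=
  ∀ i, G.Adj i i

/-! ### Plants -/

/-- The matrices with the sparsity pattern of `S`. -/
def stateMatrices {n : ℕ} (S : Matrix (Fin n) (Fin n) ℝ) : Set (Matrix (Fin n) (Fin n) ℝ) :=
  {A | ∀ i j, S i j = 0 → A i j = 0}

/-- The diagonal matrices whose smallest singular value (that is, each of the `n` singular
values) is at least `ε`. -/
def inputMatrices (n : ℕ) (ε : ℝ) : Set (Matrix (Fin n) (Fin n) ℝ) :=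
  {B | (∀ k, k < n → ε ≤ (Matrix.toEuclideanLin B).singularValues k) ∧ B.IsDiag}

/-- The diagonal matrices. -/
def disturbanceMatrices (n : ℕ) : Set (Matrix (Fin n) (Fin n) ℝ) :=
  {D | D.IsDiag}

/-- The model `(A, B, D)` of a plant with plant graph `GP`. -/
structure PlantModel {n : ℕ} (GP : Digraph (Fin n)) (ε : ℝ) where
  A : Matrix (Fin n) (Fin n) ℝ
  B : Matrix (Fin n) (Fin n) ℝ
  D : Matrix (Fin n) (Fin n) ℝ
  memA : A ∈ stateMatrices (adjacency GP)
  memB : B ∈ inputMatrices n ε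
  memD : D ∈ disturbanceMatrices n

/-- A plant `(A, B, D, x₀, w₀)`. -/
structure Plant {n : ℕ} (GP : Digraph (Fin n)) (ε : ℝ) where
  model : PlantModel GP ε
  x0 : Fin n → ℝ
  w0 : Fin n → ℝ

/-! ### Controllers -/

/-- Matrices of real rational functions in the shift variable `z = RatFunc.X`. -/
abbrev RatMatrix (n : ℕ) : Type := Matrix (Fin n) (Fin n) (RatFunc ℝ)

/-- The controllers with control graph `GK`: matrices of proper real rational functions with the
sparsity pattern of `GK`. -/
def controllers {n : ℕ} (GK : Digraph (Fin n)) : Set (RatMatrix n) :=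
  {K | (∀ i j, (K i j).intDegree ≤ 0) ∧ ∀ i j, adjacency GK i j = 0 → K i j = 0}

/-- The transfer function `C (zI - A)⁻¹ B + D` of a state-space realization. -/
def transferMatrix {n m : ℕ} (A : Matrix (Fin m) (Fin m) ℝ) (B : Matrix (Fin m) (Fin n) ℝ)
    (C : Matrix (Fin n) (Fin m) ℝ) (D : Matrix (Fin n) (Fin n) ℝ) : RatMatrix n :=
  C.map (RatFunc.C (K := ℝ)) *
    ((RatFunc.X (K := ℝ)) • (1 : Matrix (Fin m) (Fin m) (RatFunc ℝ)) -
      A.map (RatFunc.C (K := ℝ)))⁻¹ * B.map (RatFunc.C (K := ℝ)) + D.map (RatFunc.C (K := ℝ))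

/-- The `k`-th coefficient `h k` of the expansion `g(z) = ∑ k, h k * z ^ (-k)` at infinity of a
proper rational function `g`. The polynomial part of `z ^ k * g(z)` is
`∑ m ≤ k, h m * z ^ (k - m)`, and `h k` is its constant coefficient. -/
def impulse (g : RatFunc ℝ) (k : ℕ) : ℝ :=
  (((Polynomial.X : Polynomial ℝ) ^ k * g.num) / g.denom).coeff 0

/-- The impulse response of a matrix of proper rational functions. For the transfer function of
`(A, B, C, D)` it is `D, C * B, C * A * B, C * A ^ 2 * B, …`. -/
def impulseMatrix {n : ℕ} (K : RatMatrix n) (k : ℕ) : Matrix (Fin n) (Fin n) ℝ :=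
  Matrix.of fun i j => impulse (K i j) k

/-! ### Closed loop and cost -/

/-- The disturbance `w (k + 1) = D w (k)`, `w 0 = w₀`. -/
def disturbance {n : ℕ} {GP : Digraph (Fin n)} {ε : ℝ} (P : Plant GP ε) (k : ℕ) : Fin n → ℝ :=
  Matrix.mulVec (P.model.D ^ k) P.w0

/-- The state of the closed loop of the plant `P` and the controller `K`:
`x (k + 1) = A x (k) + B (u (k) + w (k))`, `x 0 = x₀`, where `u` is the response of the controller
(started at the zero controller state) to `x`, that is, the convolution of its impulse response
with `x`. -/
def closedLoopState {n : ℕ} {GP : Digraph (Fin n)} {ε : ℝ} (P : Plant GP ε) (K : RatMatrix n) :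
    ℕ → Fin n → ℝ
  | 0 => P.x0
  | k + 1 =>
      Matrix.mulVec P.model.A (closedLoopState P K k) +
        Matrix.mulVec P.model.B
          ((∑ m : Fin (k + 1),
              Matrix.mulVec (impulseMatrix K (k - m.val)) (closedLoopState P K m.val)) +
            disturbance P k)
  termination_by k => k
  decreasing_by
    · exact Nat.lt_succ_self k
    · exact m.isLt

/-- The control input of the closed loop. -/
def closedLoopInput {n : ℕ} {GP : Digraph (Fin n)} {ε : ℝ} (P : Plant GP ε) (K : RatMatrix n)
    (k : ℕ) : Fin n → ℝ :=
  ∑ m : Fin (k + 1),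
    Matrix.mulVec (impulseMatrix K (k - m.val)) (closedLoopState P K m.val)

/-- The cost `J_P(K) = ∑ k, (x(k)ᵀ x(k) + (u(k) + w(k))ᵀ (u(k) + w(k)))` in `[0, ∞]`. -/
def cost {n : ℕ} {GP : Digraph (Fin n)} {ε : ℝ} (P : Plant GP ε) (K : RatMatrix n) : ENNReal :=
  ∑' k : ℕ, ENNReal.ofReal
    ((∑ i, closedLoopState P K k i ^ 2) +
      ∑ i, (closedLoopInput P K k i + disturbance P k i) ^ 2)

/-! ### Control design strategies -/

/-- A control design strategy assigns a matrix of rational functions to every `(A, B, D)`; it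
depends neither on the initial state nor on the initial disturbance. -/
abbrev Strategy {n : ℕ} (GP : Digraph (Fin n)) (ε : ℝ) : Type := PlantModel GP ε → RatMatrix n

/-- The strategies with values in the controllers with control graph `GK` that have the structure
of the design graph `GC`: the `i`-th row of `Γ(A, B, D)` is a function only of the `j`-th row of
`A`, of `b j j` and of `d j j`, for those `j` such that `(j, i)` is an edge of `GC`. -/
def strategies {n : ℕ} (GP GK GC : Digraph (Fin n)) (ε : ℝ) : Set (Strategy GP ε) :=
  {Γ | (∀ M, Γ M ∈ controllers GK) ∧
    ∀ (i : Fin n) (M M' : PlantModel GP ε),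
      (∀ j, adjacency GC i j ≠ 0 →
        (∀ l, M.A j l = M'.A j l) ∧ M.B j j = M'.B j j ∧ M.D j j = M'.D j j) →
      ∀ l, Γ M i l = Γ M' i l}

/-- The cost `J_P(K^*(P))` of an optimal controller with control graph `GK`. As the infimum of the
costs it is defined whether or not an optimal controller exists. -/
def optimalCost {n : ℕ} {GP : Digraph (Fin n)} {ε : ℝ} (GK : Digraph (Fin n)) (P : Plant GP ε) :
    ENNReal :=
  ⨅ K ∈ controllers GK, cost P K

open Classical in
/-- The quotient of two costs, with the convention `0 / 0 = 1`. -/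
def costRatio (a b : ENNReal) : ENNReal :=
  if a = 0 ∧ b = 0 then 1 else a / b

/-- The competitive ratio `sup_P J_P(Γ(A, B, D)) / J_P(K^*(P))`. -/
def competitiveRatio {n : ℕ} {GP : Digraph (Fin n)} {ε : ℝ} (GK : Digraph (Fin n))
    (Γ : Strategy GP ε) : ENNReal :=
  ⨆ P : Plant GP ε, costRatio (cost P (Γ P.model)) (optimalCost GK P)

/-- The controllers that are optimal, with one and the same controller for all initial
disturbances, for the model `M` started at rest (`x₀ = 0`). -/
def restOptimal {n : ℕ} {GP : Digraph (Fin n)} {ε : ℝ} (GK : Digraph (Fin n))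
    (M : PlantModel GP ε) : Set (RatMatrix n) :=
  {K | K ∈ controllers GK ∧
    ∀ K' ∈ controllers GK, ∀ w0 : Fin n → ℝ, cost ⟨M, 0, w0⟩ K ≤ cost ⟨M, 0, w0⟩ K'}

/-- The competitive ratio against optimal controllers that, like `Γ`, depend on `(A, B, D)` only
and neither on the initial state nor on the initial disturbance: the supremum is over the plants
(with arbitrary `x₀` and `w₀`) whose model has a controller in `restOptimal`, and that controller
takes the place of the optimal one. -/
def blindCompetitiveRatio {n : ℕ} {GP : Digraph (Fin n)} {ε : ℝ} (GK : Digraph (Fin n))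
    (Γ : Strategy GP ε) : ENNReal :=
  ⨆ P : Plant GP ε, ⨆ K ∈ restOptimal GK P.model, costRatio (cost P (Γ P.model)) (cost P K)

/-- `Γ` dominates `Γ'`. -/
def Dominates {n : ℕ} {GP : Digraph (Fin n)} {ε : ℝ} (Γ Γ' : Strategy GP ε) : Prop :=
  (∀ P : Plant GP ε, cost P (Γ P.model) ≤ cost P (Γ' P.model)) ∧
    ∃ P : Plant GP ε, cost P (Γ P.model) < cost P (Γ' P.model)

/-- `Γ'` is an undominated member of `𝒞`. -/
def IsUndominated {n : ℕ} {GP : Digraph (Fin n)} {ε : ℝ} (𝒞 : Set (Strategy GP ε))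
    (Γ' : Strategy GP ε) : Prop :=
  Γ' ∈ 𝒞 ∧ ¬ ∃ Γ ∈ 𝒞, Dominates Γ Γ'

/-! ### The strategy `Γ^Θ` -/

open Classical in
/-- The diagonal matrix `F(A, B)`, with entry zero at the nodes that are not sinks. -/
def sinkGain {n : ℕ} {GP : Digraph (Fin n)} {ε : ℝ} (M : PlantModel GP ε) :
    Matrix (Fin n) (Fin n) ℝ :=
  Matrix.diagonal fun i =>
    if IsSink GP i then
      2 / (M.B i i ^ 2 + M.A i i ^ 2 + 1 +
        √((M.A i i ^ 2 + M.B i i ^ 2) ^ 2 + 2 * (M.B i i ^ 2 - M.A i i ^ 2) + 1))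
    else 0

/-- The strategy `Γ^Θ`: deadbeat at the nodes that are not sinks, and at the sinks the control law
that is optimal for the decoupled node. -/
def strategyTheta {n : ℕ} (GP : Digraph (Fin n)) (ε : ℝ) : Strategy GP ε := fun M =>
  transferMatrix M.D
    (M.B⁻¹ * M.D * sinkGain M * M.A - M.B⁻¹ * M.D ^ 2)
    1
    (M.B⁻¹ * (sinkGain M - 1) * M.A - M.B⁻¹ * M.D)

end

end LimitedModel

open LimitedModel

/-! Write `v = u + w` for the total input. With a totally disconnected design graph, row `i` of a
strategy sees only row `i` of `A`, `b i i` and `d i i`. The weight of an edge `i → l` sits in row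
`l`, so the controller of node `i` cannot know it, and any error left at `i` can be amplified along
that edge at will. Both parts rest on this.

(a) An off-diagonal entry of the nonsink block yields edges `j → i → l`, possibly with `l = j`. For
the infimum version the comparison controller may depend on the initial data; a static gain then
cancels the disturbance exactly, and the ratio is unbounded already for `A = 0`
(`le_competitiveRatio`). For the blind version the benchmark is a linear quadratic regulator with
diagonal value function, which is optimal from rest (`regulator_mem_restOptimal`). If `Γ` does not
cancel at once the effect of `x j` on node `i`, a large weight on `i → l` makes the ratio exceed any
bound (`le_blindCompetitiveRatio_of_not_deadbeat`). If it always does, a suitable initial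
disturbance at `i` makes this cancellation wasteful, and the ratio approaches the stated constant as
the weight `r` of `j → i` grows (`le_blindCompetitiveRatio`).

(b) `Γ^Θ` reconstructs the disturbance after one step, is deadbeat at nonsinks and follows a scalar
regulator at sinks. Once the nonsinks vanish the sinks are decoupled, and `thetaValue` is the exact
cost to go; a controller agreeing with `Γ^Θ` at the nonsinks pays in addition a sum of squares
(`stageCost_add_thetaValue`). A strategy that is nowhere worse must agree with `Γ^Θ` at the
nonsinks, since a first difference in impulse responses could be amplified (`impulse_eq_of_probe`,
`agreesNonsink_of_le`). On plants with matched initial disturbance the extra squares at time zero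
must vanish, which fixes the first input at the sinks too (`totalInput_zero_eq_of_le`). Hence no
cost is strictly smaller. -/

namespace LimitedModel

noncomputable section

/-! ### Impulse responses -/

-- Dividing `X ^ k * (γ (X - d) + β)` by `X - d` leaves the remainder `β * d ^ k`, and the constant
-- coefficient of the quotient can be read off. Uniqueness of division carries this over to the
-- reduced fraction `g.num / g.denom`.
open Polynomial in
lemma impulse_first_order (γ β d : ℝ) (k : ℕ) :
    impulse (RatFunc.C β / (RatFunc.X - RatFunc.C d) + RatFunc.C γ) k =
      if k = 0 then γ else β * d ^ (k - 1) := by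
  set g : RatFunc ℝ := RatFunc.C β / (RatFunc.X - RatFunc.C d) + RatFunc.C γ with hg
  have hq : (X - C d : ℝ[X]) ≠ 0 := X_sub_C_ne_zero d
  have hXd : (RatFunc.X - RatFunc.C d : RatFunc ℝ) = algebraMap ℝ[X] (RatFunc ℝ) (X - C d) := by
    simp
  have hnum : g.num * (X - C d) = (C γ * (X - C d) + C β) * g.denom := by
    rw [RatFunc.num_mul_eq_mul_denom_iff hq, hg, hXd]
    have : algebraMap ℝ[X] (RatFunc ℝ) (X - C d) ≠ 0 := RatFunc.algebraMap_ne_zero hq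
    rw [map_add, map_mul, RatFunc.algebraMap_C, RatFunc.algebraMap_C]
    field_simp
    ring
  have key : ∃ t : ℝ[X], t.coeff 0 = (if k = 0 then γ else β * d ^ (k - 1)) ∧
      X ^ k * (C γ * (X - C d) + C β) = t * (X - C d) + C (β * d ^ k) := by
    induction k with
    | zero => exact ⟨C γ, by simp, by simp⟩
    | succ k ih =>
      obtain ⟨t, -, ht⟩ := ih
      refine ⟨X * t + C (β * d ^ k), by simp [coeff_C_zero, -map_mul, -map_pow], ?_⟩
      have : (C (β * d ^ (k + 1)) : ℝ[X]) = C (β * d ^ k) * C d := by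
        rw [← C_mul]; ring_nf
      rw [pow_succ', mul_assoc, ht, this]
      ring
  obtain ⟨t, ht0, ht⟩ := key
  have hs : (X ^ k * g.num - t * g.denom) * (X - C d) = C (β * d ^ k) * g.denom := by
    linear_combination X ^ k * hnum + g.denom * ht
  have hdeg : (X ^ k * g.num - t * g.denom).degree < g.denom.degree := by
    by_cases h0 : X ^ k * g.num - t * g.denom = 0
    · rw [h0, degree_zero, bot_lt_iff_ne_bot]
      exact degree_ne_bot.2 g.denom_ne_zero
    · have h1 := congrArg natDegree hs
      rw [natDegree_mul h0 hq, natDegree_X_sub_C] at h1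
      refine degree_lt_degree ?_
      have := natDegree_C_mul_le (β * d ^ k) g.denom
      omega
  have := (div_modByMonic_unique (f := X ^ k * g.num) t (X ^ k * g.num - t * g.denom)
    g.monic_denom ⟨by ring, hdeg⟩).1
  rw [impulse, ← divByMonic_eq_div _ g.monic_denom, this, ht0]

lemma impulse_C (γ : ℝ) (k : ℕ) : impulse (RatFunc.C γ) k = if k = 0 then γ else 0 := by
  have := impulse_first_order γ 0 0 k
  simpa using this

lemma intDegree_first_order_le (γ β d : ℝ) :
    (RatFunc.C β / (RatFunc.X - RatFunc.C d) + RatFunc.C γ : RatFunc ℝ).intDegree ≤ 0 := by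
  have hXd : (RatFunc.X - RatFunc.C d : RatFunc ℝ) =
      algebraMap (Polynomial ℝ) (RatFunc ℝ) (Polynomial.X - Polynomial.C d) := by simp
  have hne : (RatFunc.X - RatFunc.C d : RatFunc ℝ) ≠ 0 := by
    rw [hXd]; exact RatFunc.algebraMap_ne_zero (Polynomial.X_sub_C_ne_zero d)
  have h1 : (RatFunc.C β / (RatFunc.X - RatFunc.C d) : RatFunc ℝ).intDegree ≤ 0 := by
    by_cases hβ : β = 0
    · simp [hβ]
    · rw [RatFunc.intDegree_div (by simpa using hβ) hne, hXd, RatFunc.intDegree_polynomial]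
      simp
  by_cases hγ : γ = 0
  · simpa [hγ] using h1
  by_cases hs : (RatFunc.C β / (RatFunc.X - RatFunc.C d) + RatFunc.C γ : RatFunc ℝ) = 0
  · simp [hs]
  · refine (RatFunc.intDegree_add_le (by simpa using hγ) hs).trans ?_
    simpa using h1

/-! ### Diagonal input matrices -/

/-- The squared singular values are the eigenvalues of `BᵀB`, which for diagonal `B` are the `b i i
^ 2`. -/
lemma mem_inputMatrices_iff {n : ℕ} {ε : ℝ} (B : Matrix (Fin n) (Fin n) ℝ) :
    B ∈ inputMatrices n ε ↔ B.IsDiag ∧ ∀ i, ε ≤ |B i i| := by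
  rw [inputMatrices, Set.mem_ofPred_eq, and_comm]
  refine and_congr_right fun hB => ?_
  obtain ⟨b, rfl⟩ : ∃ b : Fin n → ℝ, B = Matrix.diagonal b := ⟨_, hB.diagonal_diag.symm⟩
  set T := Matrix.toEuclideanLin (Matrix.diagonal b) with hT
  have hfr : Module.finrank ℝ (EuclideanSpace ℝ (Fin n)) = n := by simp
  have happ : ∀ x i, T x i = b i * x i := by
    intro x i
    simp [hT, Matrix.toLpLin_apply, Matrix.mulVec_diagonal]
  have hadj : LinearMap.adjoint T = T := by
    rw [hT, ← Matrix.toEuclideanLin_conjTranspose_eq_adjoint]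
    congr 1
    rw [Matrix.diagonal_conjTranspose]
    congr 1
  have hcomp : ∀ x i, (LinearMap.adjoint T ∘ₗ T) x i = b i ^ 2 * x i := by
    intro x i
    rw [hadj, LinearMap.comp_apply, happ, happ]; ring
  simp only [Matrix.diagonal_apply_eq]
  constructor
  · intro h i
    have hev : Module.End.HasEigenvalue (LinearMap.adjoint T ∘ₗ T) (b i ^ 2) := by
      refine Module.End.hasEigenvalue_of_hasEigenvector
        (x := EuclideanSpace.single i (1 : ℝ)) ⟨?_, ?_⟩
      · rw [Module.End.mem_eigenspace_iff]
        ext j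
        rw [hcomp]
        by_cases hj : j = i
        · subst hj; simp
        · simp [hj]
      · simp
    obtain ⟨k, hk⟩ := T.isSymmetric_adjoint_comp_self.exists_eigenvalues_eq hfr hev
    have h2 := T.sq_singularValues_fin hfr k
    have h3 := h k k.isLt
    have h4 : T.singularValues k ^ 2 = b i ^ 2 := by
      rw [h2]; exact_mod_cast hk
    exact h3.trans ((le_abs_self _).trans ((sq_eq_sq_iff_abs_eq_abs _ _).1 h4).le)
  · intro h k hk
    obtain ⟨v, hv⟩ := (T.hasEigenvalue_adjoint_comp_self_sq_singularValues
      (n := k) (by rw [hfr]; exact hk)).exists_hasEigenvector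
    obtain ⟨j, hj⟩ : ∃ j, v j ≠ 0 := by
      by_contra! hc
      exact hv.2 (by ext j; simp [hc j])
    have := congrArg (fun y : EuclideanSpace ℝ (Fin n) => y j) hv.apply_eq_smul
    simp only [hcomp, PiLp.smul_apply, smul_eq_mul] at this
    have h4 : b j ^ 2 = T.singularValues k ^ 2 := mul_right_cancel₀ hj this
    rw [← abs_of_nonneg (T.singularValues_nonneg k), ← (sq_eq_sq_iff_abs_eq_abs _ _).1 h4]
    exact h j

variable {n : ℕ} {GP GK GC : Digraph (Fin n)} {ε : ℝ}

/-! ### Closed loops in coordinates -/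

/-- The total input `u + w` of the closed loop. -/
def totalInput (P : Plant GP ε) (K : RatMatrix n) (k : ℕ) (i : Fin n) : ℝ :=
  closedLoopInput P K k i + disturbance P k i

/-- The cost incurred at one instant. -/
def stageCost (P : Plant GP ε) (K : RatMatrix n) (k : ℕ) : ℝ :=
  ∑ i, (closedLoopState P K k i ^ 2 + totalInput P K k i ^ 2)

lemma stageCost_nonneg (P : Plant GP ε) (K : RatMatrix n) (k : ℕ) : 0 ≤ stageCost P K k :=
  Finset.sum_nonneg fun _ _ => by positivity

lemma cost_eq (P : Plant GP ε) (K : RatMatrix n) :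
    cost P K = ∑' k, ENNReal.ofReal (stageCost P K k) := by
  simp only [cost, stageCost, totalInput, Finset.sum_add_distrib]

lemma PlantModel.A_eq_zero (M : PlantModel GP ε) {i j : Fin n} (h : ¬ GP.Adj j i) :
    M.A i j = 0 :=
  M.memA i j (by simp [adjacency, h])

lemma PlantModel.B_eq (M : PlantModel GP ε) : M.B = Matrix.diagonal fun i => M.B i i :=
  M.memB.2.diagonal_diag.symm

lemma PlantModel.D_eq (M : PlantModel GP ε) : M.D = Matrix.diagonal fun i => M.D i i :=
  Matrix.IsDiag.diagonal_diag (show M.D.IsDiag from M.memD) |>.symm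

lemma PlantModel.B_ne_zero (hε : 0 < ε) (M : PlantModel GP ε) (i : Fin n) : M.B i i ≠ 0 := by
  have := ((mem_inputMatrices_iff M.B).1 M.memB).2 i
  exact abs_pos.1 (hε.trans_le this)

lemma disturbance_apply (P : Plant GP ε) (k : ℕ) (i : Fin n) :
    disturbance P k i = P.model.D i i ^ k * P.w0 i := by
  rw [disturbance, P.model.D_eq, Matrix.diagonal_pow, Matrix.mulVec_diagonal]
  simp

@[simp]
lemma closedLoopState_zero (P : Plant GP ε) (K : RatMatrix n) :
    closedLoopState P K 0 = P.x0 := by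
  rw [closedLoopState]

lemma closedLoopState_succ (P : Plant GP ε) (K : RatMatrix n) (k : ℕ) (i : Fin n) :
    closedLoopState P K (k + 1) i =
      P.model.A.mulVec (closedLoopState P K k) i + P.model.B i i * totalInput P K k i := by
  rw [closedLoopState, Pi.add_apply, P.model.B_eq, Matrix.mulVec_diagonal]
  simp [totalInput, closedLoopInput]

/-- The response at time `k` of the row `g` of a controller to the sequence `x` of states. -/
def rowResponse (g : Fin n → RatFunc ℝ) (x : ℕ → Fin n → ℝ) (k : ℕ) : ℝ :=
  ∑ m ∈ Finset.range (k + 1), ∑ l, impulse (g l) (k - m) * x m l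

lemma closedLoopInput_apply (P : Plant GP ε) (K : RatMatrix n) (k : ℕ) (i : Fin n) :
    closedLoopInput P K k i = rowResponse (K i) (closedLoopState P K) k := by
  rw [closedLoopInput, Finset.sum_apply, rowResponse,
    ← Fin.sum_univ_eq_sum_range
      (fun m => ∑ l, impulse (K i l) (k - m) * closedLoopState P K m l)]
  rfl

lemma totalInput_eq (P : Plant GP ε) (K : RatMatrix n) (k : ℕ) (i : Fin n) :
    totalInput P K k i =
      rowResponse (K i) (closedLoopState P K) k + P.model.D i i ^ k * P.w0 i := by
  rw [totalInput, closedLoopInput_apply, disturbance_apply]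

lemma rowResponse_zero (g : Fin n → RatFunc ℝ) (x : ℕ → Fin n → ℝ) :
    rowResponse g x 0 = ∑ l, impulse (g l) 0 * x 0 l := by
  simp [rowResponse]

lemma totalInput_zero (P : Plant GP ε) (K : RatMatrix n) (i : Fin n) :
    totalInput P K 0 i = ∑ l, impulse (K i l) 0 * P.x0 l + P.w0 i := by
  simp [totalInput_eq, rowResponse_zero]

lemma rowResponse_C (L : Fin n → ℝ) (x : ℕ → Fin n → ℝ) (k : ℕ) :
    rowResponse (fun l => RatFunc.C (L l)) x k = ∑ l, L l * x k l := by
  rw [rowResponse, Finset.sum_range_succ, Finset.sum_eq_zero]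
  · simp [impulse_C]
  · intro m hm
    have : k - m ≠ 0 := by have := Finset.mem_range.1 hm; omega
    simp [impulse_C, this]

/-! ### Bounds for the cost -/

lemma ofReal_sum_stageCost_le_cost (P : Plant GP ε) (K : RatMatrix n) (N : ℕ) :
    ENNReal.ofReal (∑ k ∈ Finset.range N, stageCost P K k) ≤ cost P K := by
  rw [cost_eq, ENNReal.ofReal_sum_of_nonneg fun _ _ => stageCost_nonneg P K _]
  exact ENNReal.sum_le_tsum _

/-- The cost is bounded below by the cost of one node, split at the state transitions. -/
lemma ofReal_sum_node_le_cost (P : Plant GP ε) (K : RatMatrix n) (N : ℕ) (l : Fin n) :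
    ENNReal.ofReal (P.x0 l ^ 2 + ∑ k ∈ Finset.range N,
      (totalInput P K k l ^ 2 + closedLoopState P K (k + 1) l ^ 2)) ≤ cost P K := by
  -- The state at time `N` belongs to stage `N`, so `N + 1` stages are used and the input at time
  -- `N` is discarded.
  refine le_trans (ENNReal.ofReal_le_ofReal ?_) (ofReal_sum_stageCost_le_cost P K (N + 1))
  have h : ∀ k, closedLoopState P K k l ^ 2 + totalInput P K k l ^ 2 ≤ stageCost P K k :=
    fun k => Finset.single_le_sum
      (f := fun i => closedLoopState P K k i ^ 2 + totalInput P K k i ^ 2)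
      (fun _ _ => by positivity) (Finset.mem_univ l)
  refine le_trans ?_ (Finset.sum_le_sum fun k _ => h k)
  rw [Finset.sum_add_distrib, Finset.sum_add_distrib, Finset.sum_range_succ',
    Finset.sum_range_succ (fun k => totalInput P K k l ^ 2)]
  have := sq_nonneg (totalInput P K N l)
  simp only [closedLoopState_zero]
  linarith

/-- Telescoping. Stage zero is kept apart because only there does the controller act without
information on the disturbance. -/
lemma cost_le_of_potential (P : Plant GP ε) (K : RatMatrix n) (V : (Fin n → ℝ) → ℝ)
    (hV : ∀ x, 0 ≤ V x)
    (h : ∀ k, 1 ≤ k → stageCost P K k + V (closedLoopState P K (k + 1)) ≤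
      V (closedLoopState P K k)) :
    cost P K ≤ ENNReal.ofReal (stageCost P K 0 + V (closedLoopState P K 1)) := by
  rw [cost_eq]
  refine ENNReal.tsum_le_of_sum_range_le fun N => ?_
  rw [← ENNReal.ofReal_sum_of_nonneg fun _ _ => stageCost_nonneg P K _]
  refine ENNReal.ofReal_le_ofReal ?_
  have key : ∀ N, ∑ k ∈ Finset.range (N + 1), stageCost P K k + V (closedLoopState P K (N + 1)) ≤
      stageCost P K 0 + V (closedLoopState P K 1) := by
    intro N
    induction N with
    | zero => simp
    | succ N ih =>
      rw [Finset.sum_range_succ]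
      linarith [h (N + 1) (by omega)]
  rcases N with _ | N
  · simpa using add_nonneg (stageCost_nonneg P K 0) (hV _)
  · linarith [key N, hV (closedLoopState P K (N + 1))]

-- Telescoping leaves the tail `V (x (N + 1))`. A finite cost forces the states to tend to zero, and
-- the tail with them.
open Filter Topology in
lemma le_cost_of_potential (P : Plant GP ε) (K : RatMatrix n) (V : (Fin n → ℝ) → ℝ)
    (hV : Continuous V) (hV0 : V 0 = 0)
    (h : ∀ k, 1 ≤ k → V (closedLoopState P K k) ≤
      stageCost P K k + V (closedLoopState P K (k + 1))) :
    ENNReal.ofReal (stageCost P K 0 + V (closedLoopState P K 1)) ≤ cost P K := by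
  by_cases htop : cost P K = ⊤
  · simp [htop]
  rw [cost_eq] at htop
  have hsum : Summable (stageCost P K) := by
    have := ENNReal.summable_toReal htop
    simpa only [ENNReal.toReal_ofReal (stageCost_nonneg P K _)] using this
  rw [cost_eq, ← ENNReal.ofReal_tsum_of_nonneg (stageCost_nonneg P K) hsum]
  refine ENNReal.ofReal_le_ofReal ?_
  have hx : Tendsto (closedLoopState P K) atTop (𝓝 0) := by
    rw [tendsto_pi_nhds]
    intro i
    have h2 : Tendsto (fun k => closedLoopState P K k i ^ 2) atTop (𝓝 0) := by
      refine squeeze_zero (fun _ => sq_nonneg _) (fun k => ?_) hsum.tendsto_atTop_zero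
      refine le_trans ?_ (Finset.single_le_sum
        (f := fun i => closedLoopState P K k i ^ 2 + totalInput P K k i ^ 2)
        (fun _ _ => by positivity) (Finset.mem_univ i))
      have := sq_nonneg (totalInput P K k i)
      linarith
    have h3 := h2.sqrt
    simp only [Real.sqrt_sq_eq_abs, Real.sqrt_zero] at h3
    exact (tendsto_zero_iff_abs_tendsto_zero _).2 h3
  have hVx : Tendsto (fun N => V (closedLoopState P K (N + 1))) atTop (𝓝 0) := by
    have := (hV.tendsto 0).comp hx
    rw [hV0] at this
    exact this.comp (tendsto_add_atTop_nat 1)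
  have key : ∀ N, stageCost P K 0 + V (closedLoopState P K 1) ≤
      ∑ k ∈ Finset.range (N + 1), stageCost P K k + V (closedLoopState P K (N + 1)) := by
    intro N
    induction N with
    | zero => simp
    | succ N ih =>
      rw [Finset.sum_range_succ]
      linarith [h (N + 1) (by omega)]
  have hlim := (hsum.tendsto_sum_tsum_nat.comp (tendsto_add_atTop_nat 1)).add hVx
  rw [add_zero] at hlim
  exact ge_of_tendsto' hlim key

/-! ### Models with scalar input matrix and constant disturbance -/

/-- The model with `B = ε I` and `D = 0`. -/
def scalarModel (hε : 0 < ε) (A : Matrix (Fin n) (Fin n) ℝ)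
    (hA : A ∈ stateMatrices (adjacency GP)) : PlantModel GP ε where
  A := A
  B := Matrix.diagonal fun _ => ε
  D := 0
  memA := hA
  memB := (mem_inputMatrices_iff _).2
    ⟨Matrix.isDiag_diagonal _, fun i => by simp [abs_of_pos hε]⟩
  memD := Matrix.isDiag_zero

lemma mem_stateMatrices {A : Matrix (Fin n) (Fin n) ℝ} (h : ∀ i j, A i j ≠ 0 → GP.Adj j i) :
    A ∈ stateMatrices (adjacency GP) := by
  intro i j hij
  by_contra hne
  simp [adjacency, h i j hne] at hij

lemma adj_self_of_hasAllLoops (hK : HasAllLoops GK) {i j : Fin n} (h : ¬ GK.Adj j i) :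
    i ≠ j := by
  rintro rfl
  exact h (hK i)

/-- The static controller with gain matrix `L`. -/
def staticController (L : Matrix (Fin n) (Fin n) ℝ) : RatMatrix n := fun i l => RatFunc.C (L i l)

lemma staticController_mem {L : Matrix (Fin n) (Fin n) ℝ}
    (h : ∀ i j, ¬ GK.Adj j i → L i j = 0) : staticController L ∈ controllers GK := by
  refine ⟨fun i j => by simp [staticController], fun i j hij => ?_⟩
  have : ¬ GK.Adj j i := fun hadj => by simp [adjacency, hadj] at hij
  simp [staticController, h i j this]

lemma totalInput_staticController (P : Plant GP ε) (L : Matrix (Fin n) (Fin n) ℝ) (k : ℕ)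
    (i : Fin n) :
    totalInput P (staticController L) k i =
      L.mulVec (closedLoopState P (staticController L) k) i + P.model.D i i ^ k * P.w0 i := by
  rw [totalInput_eq]
  exact congrArg (· + _) (rowResponse_C (L i) _ k)

lemma ofReal_div_le_costRatio {a b : ENNReal} {α β : ℝ} (ha : ENNReal.ofReal α ≤ a)
    (hb : b ≤ ENNReal.ofReal β) (hβ : 0 < β) : ENNReal.ofReal (α / β) ≤ costRatio a b := by
  rcases le_or_gt α 0 with hα | hα
  · rw [ENNReal.ofReal_of_nonpos (div_nonpos_of_nonpos_of_nonneg hα hβ.le)]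
    exact zero_le
  · have ha0 : a ≠ 0 := fun h => by
      rw [h] at ha
      exact (ENNReal.ofReal_pos.2 hα).not_ge ha
    rw [costRatio, if_neg fun h => ha0 h.1, ENNReal.ofReal_div_of_pos hβ]
    exact ENNReal.div_le_div ha hb

/-- Without a restriction on the information of the optimal controller about the initial
disturbance every competitive ratio is infinite. -/
lemma le_competitiveRatio (hε : 0 < ε) (hK : HasAllLoops GK) (Γ : Strategy GP ε) (i : Fin n)
    (ρ : ℝ) (hρ : 0 ≤ ρ) : ENNReal.ofReal ρ ≤ competitiveRatio GK Γ := by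
  set M : PlantModel GP ε := scalarModel hε 0 (mem_stateMatrices fun _ _ h => absurd rfl h) with hM
  set h := impulse (Γ M i i) 0
  -- The model, and hence `h`, is fixed before `t`, so `t` may exceed `|h|`. The gain `-t` at node
  -- `i` turns the state `t⁻¹` into the input `-1`, which cancels the disturbance.
  set t : ℝ := |h| + ρ + 1 with ht
  have ht0 : 0 < t := by positivity
  set P : Plant GP ε := ⟨M, Pi.single i t⁻¹, Pi.single i 1⟩ with hP
  refine le_trans ?_ (le_iSup _ P)
  have hopt : optimalCost GK P ≤ ENNReal.ofReal (t⁻¹ ^ 2) := by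
    set K : RatMatrix n := staticController (Matrix.diagonal (Pi.single i (-t)))
    have hKm : K ∈ controllers GK := staticController_mem fun a b hab =>
      Matrix.diagonal_apply_ne _ (adj_self_of_hasAllLoops hK hab)
    refine (iInf₂_le K hKm).trans ?_
    have hv0 : ∀ q, totalInput P K 0 q = 0 := by
      intro q
      rw [totalInput_staticController, Matrix.mulVec_diagonal]
      by_cases hq : q = i
      · subst hq; simp [hP, ht0.ne']
      · simp [hP, hq]
    have hx : ∀ k, closedLoopState P K (k + 1) = 0 := by
      intro k
      induction k with
      | zero =>
        ext q
        rw [closedLoopState_succ, hv0]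
        simp [hP, hM, scalarModel]
      | succ k ih =>
        ext q
        rw [closedLoopState_succ, totalInput_staticController, ih]
        simp [hP, hM, scalarModel]
    refine (cost_le_of_potential P K (fun _ => 0) (fun _ => le_rfl) fun k hk => ?_).trans ?_
    · obtain ⟨k, rfl⟩ := Nat.exists_eq_add_of_le' hk
      rw [stageCost]
      have hv : ∀ q, totalInput P K (k + 1) q = 0 := fun q => by
        rw [totalInput_staticController, hx]
        simp [hP, hM, scalarModel]
      simp [hx, hv]
    · rw [stageCost]
      simp only [hv0]
      refine ENNReal.ofReal_le_ofReal ?_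
      simp [hP, Pi.single_apply, ite_pow]
  have hcost := ofReal_sum_node_le_cost P (Γ P.model) 1 i
  refine le_trans (ENNReal.ofReal_le_ofReal ?_)
    (ofReal_div_le_costRatio hcost hopt (by positivity))
  have hv : totalInput P (Γ P.model) 0 i = h * t⁻¹ + 1 := by
    rw [totalInput_zero]
    simp [hP, h, Pi.single_apply]
  rw [le_div_iff₀ (by positivity), Finset.sum_range_one, hv]
  have h1 : (t + h) ^ 2 * t⁻¹ ^ 2 = (h * t⁻¹ + 1) ^ 2 := by field_simp; ring
  have h2 : ρ + 1 ≤ t + h := by linarith [neg_abs_le h]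
  have h3 : ρ ≤ (t + h) ^ 2 := by nlinarith
  have h4 := mul_le_mul_of_nonneg_right h3 (sq_nonneg t⁻¹)
  nlinarith [sq_nonneg (P.x0 i), sq_nonneg (closedLoopState P (Γ P.model) (0 + 1) i)]

/-! ### Controllers that are optimal from rest -/

/-- The gain `x / (1 + ε² x)` of one step of the Riccati recursion. -/
def riccatiGain (ε x : ℝ) : ℝ := x / (1 + ε ^ 2 * x)

/-- The diagonal matrix `X` solves the Riccati equation of the model with `B = ε I`. -/
structure IsRiccatiSolution (ε : ℝ) (A : Matrix (Fin n) (Fin n) ℝ) (X : Fin n → ℝ) : Prop where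
  nonneg : ∀ q, 0 ≤ X q
  eq : ∀ x : Fin n → ℝ, ∑ m, X m * x m ^ 2 =
    ∑ m, x m ^ 2 + ∑ q, riccatiGain ε (X q) * A.mulVec x q ^ 2

/-- The controller of the linear quadratic regulator with a diagonal value function. -/
def regulator (ε : ℝ) (A : Matrix (Fin n) (Fin n) ℝ) (X : Fin n → ℝ) : RatMatrix n :=
  staticController (Matrix.diagonal (fun q => -(ε * riccatiGain ε (X q))) * A)

lemma complete_square {ε X : ℝ} (hX : 0 ≤ X) (y v : ℝ) :
    v ^ 2 + X * (y + ε * v) ^ 2 =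
      riccatiGain ε X * y ^ 2 + (1 + ε ^ 2 * X) * (v + ε * riccatiGain ε X * y) ^ 2 := by
  have : 1 + ε ^ 2 * X ≠ 0 := by positivity
  rw [riccatiGain]
  field_simp
  ring

/-- Bellman identity: the excess over the value function is a weighted square of the deviation from
the regulator's law. -/
lemma stageCost_add_value (hε : 0 < ε) {A : Matrix (Fin n) (Fin n) ℝ}
    (hA : A ∈ stateMatrices (adjacency GP)) {X : Fin n → ℝ} (hX : IsRiccatiSolution ε A X)
    (x0 w0 : Fin n → ℝ) (K : RatMatrix n) (k : ℕ) :
    stageCost ⟨scalarModel hε A hA, x0, w0⟩ K k +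
        ∑ q, X q * closedLoopState ⟨scalarModel hε A hA, x0, w0⟩ K (k + 1) q ^ 2 =
      ∑ q, X q * closedLoopState ⟨scalarModel hε A hA, x0, w0⟩ K k q ^ 2 +
        ∑ q, (1 + ε ^ 2 * X q) *
          (totalInput ⟨scalarModel hε A hA, x0, w0⟩ K k q + ε * riccatiGain ε (X q) *
            A.mulVec (closedLoopState ⟨scalarModel hε A hA, x0, w0⟩ K k) q) ^ 2 := by
  rw [stageCost, Finset.sum_add_distrib,
    hX.eq (closedLoopState ⟨scalarModel hε A hA, x0, w0⟩ K k), add_assoc, add_assoc, add_right_inj,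
    ← Finset.sum_add_distrib, ← Finset.sum_add_distrib]
  refine Finset.sum_congr rfl fun q _ => ?_
  rw [closedLoopState_succ]
  simpa [scalarModel] using complete_square (hX.nonneg q) _ _

lemma totalInput_regulator (hε : 0 < ε) {A : Matrix (Fin n) (Fin n) ℝ}
    (hA : A ∈ stateMatrices (adjacency GP)) (X x0 w0 : Fin n → ℝ) (k : ℕ) (q : Fin n) :
    totalInput ⟨scalarModel hε A hA, x0, w0⟩ (regulator ε A X) k q +
      ε * riccatiGain ε (X q) * A.mulVec (closedLoopState ⟨scalarModel hε A hA, x0, w0⟩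
        (regulator ε A X) k) q = if k = 0 then w0 q else 0 := by
  rw [regulator, totalInput_staticController, ← Matrix.mulVec_mulVec, Matrix.mulVec_diagonal]
  rcases k with _ | k <;> simp [scalarModel]

lemma cost_regulator_le (hε : 0 < ε) {A : Matrix (Fin n) (Fin n) ℝ}
    (hA : A ∈ stateMatrices (adjacency GP)) {X : Fin n → ℝ} (hX : IsRiccatiSolution ε A X)
    (x0 w0 : Fin n → ℝ) :
    cost ⟨scalarModel hε A hA, x0, w0⟩ (regulator ε A X) ≤
      ENNReal.ofReal (∑ q, X q * x0 q ^ 2 + ∑ q, (1 + ε ^ 2 * X q) * w0 q ^ 2) := by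
  refine (cost_le_of_potential _ _ (fun x => ∑ q, X q * x q ^ 2)
    (fun x => Finset.sum_nonneg fun q _ => mul_nonneg (hX.nonneg q) (sq_nonneg _))
    fun k hk => ?_).trans ?_
  · rw [stageCost_add_value hε hA hX]
    simp only [totalInput_regulator, if_neg (by omega : k ≠ 0)]
    simp
  · rw [stageCost_add_value hε hA hX]
    have h0 := totalInput_regulator hε hA X x0 w0 0
    rw [closedLoopState_zero] at h0 ⊢
    simp only [h0, if_true, le_refl]

/-- From rest, the total input at time zero is `w0` under every controller, so the first square
cannot be influenced. As `D = 0`, the regulator makes all later squares vanish. -/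
lemma regulator_mem_restOptimal (hε : 0 < ε) {A : Matrix (Fin n) (Fin n) ℝ}
    (hA : A ∈ stateMatrices (adjacency GP)) {X : Fin n → ℝ} (hX : IsRiccatiSolution ε A X)
    (hPK : GP ≤ GK) : regulator ε A X ∈ restOptimal GK (scalarModel (GP := GP) hε A hA) := by
  refine ⟨staticController_mem fun i j hij => ?_, fun K' _ w0 => ?_⟩
  · have : A i j = 0 :=
      hA i j (by simp [adjacency, show ¬ GP.Adj j i from fun h => hij (hPK h)])
    simp [Matrix.diagonal_mul, this]
  · refine (cost_regulator_le hε hA hX 0 w0).trans ?_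
    refine le_trans (le_of_eq ?_) (le_cost_of_potential _ _ (fun x => ∑ q, X q * x q ^ 2)
      (by fun_prop) (by simp) fun k _ => ?_)
    · rw [stageCost_add_value hε hA hX]
      simp [totalInput_zero]
    · rw [stageCost_add_value hε hA hX]
      exact le_add_of_nonneg_right (Finset.sum_nonneg fun q _ =>
        mul_nonneg (by nlinarith [mul_nonneg (sq_nonneg ε) (hX.nonneg q)]) (sq_nonneg _))

/-! ### Two consecutive edges -/

/-- The matrix whose only nonzero entries are `r` at `(i, j)` and `s` at `(l, i)`. -/
def pathMatrix (j i l : Fin n) (r s : ℝ) : Matrix (Fin n) (Fin n) ℝ := fun q m =>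
  if q = i then (if m = j then r else 0) else if q = l then (if m = i then s else 0) else 0

lemma pathMatrix_mem {j i l : Fin n} (hji : GP.Adj j i) (hil : GP.Adj i l) (r s : ℝ) :
    pathMatrix j i l r s ∈ stateMatrices (adjacency GP) := by
  refine mem_stateMatrices fun q m h => ?_
  simp only [pathMatrix] at h
  split_ifs at h with h1 h2 h3 h4 <;> simp_all

lemma pathMatrix_mulVec {j i l : Fin n} (r s : ℝ) (x : Fin n → ℝ) (q : Fin n) :
    (pathMatrix j i l r s).mulVec x q =
      if q = i then r * x j else if q = l then s * x i else 0 := by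
  simp only [Matrix.mulVec, dotProduct, pathMatrix]
  split_ifs <;> simp

/-- Every row of the path matrix has at most one nonzero entry, so the Riccati equation preserves
diagonal matrices and becomes scalar equations in which `X j` depends on `X i` and `X i` on `X l`.
They can be solved successively unless `l = j`; then they form a cycle and a fixed point is needed.
-/
lemma exists_pathMatrix_riccati (hε : 0 < ε) {j i l : Fin n} (hji : j ≠ i) (hil : i ≠ l) (r s : ℝ) :
    ∃ X : Fin n → ℝ, IsRiccatiSolution ε (pathMatrix j i l r s) X ∧ ∀ m, 1 ≤ X m ∧ X m =
      1 + (if m = j then r ^ 2 * riccatiGain ε (X i) else 0) +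
        (if m = i then s ^ 2 * riccatiGain ε (X l) else 0) := by
  suffices h : ∃ X : Fin n → ℝ, ∀ m, 1 ≤ X m ∧ X m =
      1 + (if m = j then r ^ 2 * riccatiGain ε (X i) else 0) +
        (if m = i then s ^ 2 * riccatiGain ε (X l) else 0) by
    obtain ⟨X, hX⟩ := h
    refine ⟨X, ⟨fun q => by linarith [(hX q).1], fun x => ?_⟩, hX⟩
    have h1 : ∀ m, X m * x m ^ 2 = x m ^ 2 +
        (if m = j then r ^ 2 * riccatiGain ε (X i) * x j ^ 2 else 0) +
        (if m = i then s ^ 2 * riccatiGain ε (X l) * x i ^ 2 else 0) := fun m => by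
      rw [(hX m).2]
      split_ifs <;> subst_vars <;> ring
    have h2 : ∀ q, riccatiGain ε (X q) * (pathMatrix j i l r s).mulVec x q ^ 2 =
        (if q = i then r ^ 2 * riccatiGain ε (X i) * x j ^ 2 else 0) +
        (if q = l then s ^ 2 * riccatiGain ε (X l) * x i ^ 2 else 0) := fun q => by
      rw [pathMatrix_mulVec]
      by_cases hqi : q = i
      · subst hqi; simp [hil]; ring
      · by_cases hql : q = l
        · subst hql; simp [hil.symm]; ring
        · simp [hqi, hql]
    simp only [h1, h2, Finset.sum_add_distrib, Finset.sum_ite_eq', Finset.mem_univ, if_true]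
    ring
  set φ : ℝ → ℝ := riccatiGain ε with hφ
  have hφ0 : ∀ x, 0 ≤ x → 0 ≤ φ x := fun x hx => by
    rw [hφ, riccatiGain]; positivity
  have hφc : ContinuousOn φ (Set.Ici 0) := by
    refine continuousOn_id.div (by fun_prop) fun x hx => ?_
    have : 0 ≤ ε ^ 2 * x := mul_nonneg (sq_nonneg ε) hx
    positivity
  -- `c` is the value of `X l`. In the cyclic case the bound `φ ≤ 1 / ε ^ 2` provides an interval
  -- that is mapped into itself.
  obtain ⟨c, hc1, hc⟩ : ∃ c : ℝ, 1 ≤ c ∧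
      c = 1 + if l = j then r ^ 2 * φ (1 + s ^ 2 * φ c) else 0 := by
    by_cases hlj : l = j
    · simp only [hlj, if_true]
      have hU : ∀ x, 0 ≤ x → φ x ≤ 1 / ε ^ 2 := fun x hx => by
        rw [hφ, riccatiGain, div_le_div_iff₀ (by positivity) (by positivity)]
        linarith
      have hmem : ∀ x ∈ Set.Icc 1 (1 + r ^ 2 * (1 / ε ^ 2)), 0 ≤ s ^ 2 * φ x := fun x hx =>
        mul_nonneg (sq_nonneg s) (hφ0 x (by linarith [hx.1]))
      obtain ⟨c, hc, hfix⟩ := exists_mem_Icc_isFixedPt_of_mapsTo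
        (a := 1) (b := 1 + r ^ 2 * (1 / ε ^ 2)) (f := fun x => 1 + r ^ 2 * φ (1 + s ^ 2 * φ x))
        (continuousOn_const.add (continuousOn_const.mul (hφc.comp
          (continuousOn_const.add (continuousOn_const.mul
            (hφc.mono fun x hx => by simpa using zero_le_one.trans hx.1)))
          fun x hx => by have := hmem x hx; exact add_nonneg zero_le_one this)))
        (by simp; positivity)
        fun x hx => ⟨by
          have := mul_nonneg (sq_nonneg r)
            (hφ0 (1 + s ^ 2 * φ x) (by linarith [hmem x hx]))
          linarith, by
          have := mul_le_mul_of_nonneg_left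
            (hU (1 + s ^ 2 * φ x) (by linarith [hmem x hx])) (sq_nonneg r)
          linarith⟩
      exact ⟨c, hc.1, hfix.symm⟩
    · exact ⟨1, le_rfl, by simp [hlj]⟩
  refine ⟨fun m => 1 + (if m = j then r ^ 2 * φ (1 + s ^ 2 * φ c) else 0) +
    (if m = i then s ^ 2 * φ c else 0), fun m => ⟨?_, ?_⟩⟩
  · have h1 := hφ0 c (by linarith)
    have h2 := hφ0 (1 + s ^ 2 * φ c) (by positivity)
    have h3 : 0 ≤ r ^ 2 * φ (1 + s ^ 2 * φ c) := by positivity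
    have h4 : 0 ≤ s ^ 2 * φ c := by positivity
    dsimp only
    split_ifs <;> linarith
  · simp only [if_neg hji.symm, if_neg hil.symm, if_true, add_zero, ← hc]

/-! ### The lower bound for the competitive ratio -/

/-- With a totally disconnected design graph a row of the controller depends only on the data of
its own node. -/
lemma strategies_row_eq (hC : TotallyDisconnectedGraph GC) {Γ : Strategy GP ε}
    (hΓ : Γ ∈ strategies GP GK GC ε) {i : Fin n} {M M' : PlantModel GP ε}
    (hA : ∀ l, M.A i l = M'.A i l) (hB : M.B i i = M'.B i i) (hD : M.D i i = M'.D i i)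
    (l : Fin n) : Γ M i l = Γ M' i l := by
  refine hΓ.2 i M M' (fun j hj => ?_) l
  have hji : j = i := by
    by_contra hne
    simp [adjacency, hC j i hne] at hj
  subst hji
  exact ⟨hA, hB, hD⟩

lemma le_blindCompetitiveRatio_of_lt (hε : 0 < ε) (hPK : GP ≤ GK) {Γ : Strategy GP ε}
    {A : Matrix (Fin n) (Fin n) ℝ} (hA : A ∈ stateMatrices (adjacency GP)) {X : Fin n → ℝ}
    (hX : IsRiccatiSolution ε A X) (x0 w0 : Fin n → ℝ) {α β : ℝ}
    (hα : ENNReal.ofReal α ≤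
      cost ⟨scalarModel hε A hA, x0, w0⟩ (Γ (scalarModel (GP := GP) hε A hA)))
    (hβ : ∑ q, X q * x0 q ^ 2 + ∑ q, (1 + ε ^ 2 * X q) * w0 q ^ 2 = β) (hβ0 : 0 < β) :
    ENNReal.ofReal (α / β) ≤ blindCompetitiveRatio GK Γ := by
  refine le_trans (ofReal_div_le_costRatio hα
    ((cost_regulator_le hε hA hX x0 w0).trans (le_of_eq (by rw [hβ]))) hβ0) ?_
  exact le_iSup_of_le (⟨scalarModel hε A hA, x0, w0⟩ : Plant GP ε)
    (le_iSup₂_of_le _ (regulator_mem_restOptimal hε hA hX hPK) le_rfl)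

/-- The left side is the minimum over `v`: the least price at which a node can absorb an incoming
signal `y`. -/
lemma sq_div_le_add_sq {ε : ℝ} (y v : ℝ) :
    y ^ 2 / (1 + ε ^ 2) ≤ v ^ 2 + (y + ε * v) ^ 2 := by
  rw [div_le_iff₀ (by positivity)]
  nlinarith [sq_nonneg (v * (1 + ε ^ 2) + ε * y)]

/-- A strategy that is not deadbeat at a node from which an edge leaves has an infinite
competitive ratio. -/
lemma le_blindCompetitiveRatio_of_not_deadbeat (hε : 0 < ε) (hC : TotallyDisconnectedGraph GC)
    (hPK : GP ≤ GK) {Γ : Strategy GP ε} (hΓ : Γ ∈ strategies GP GK GC ε) {j i l : Fin n}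
    (hji : GP.Adj j i) (hil : GP.Adj i l) (hne : j ≠ i) (hne' : i ≠ l) (r : ℝ)
    (hδ : r + ε * impulse
      (Γ (scalarModel hε (pathMatrix j i l r 0) (pathMatrix_mem hji hil r 0)) i j) 0 ≠ 0)
    (ρ : ℝ) (hρ : 0 ≤ ρ) : ENNReal.ofReal ρ ≤ blindCompetitiveRatio GK Γ := by
  set δ := r + ε * impulse
    (Γ (scalarModel hε (pathMatrix j i l r 0) (pathMatrix_mem hji hil r 0)) i j) 0 with hδd
  set b : ℝ := 1 + r ^ 2 / ε ^ 2 with hb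
  -- Row `i` does not contain `s`, so `δ` is the same for all `s`. This choice makes node `l` pay at
  -- least `ρ * b`, where `b` bounds `X j` independently of `s`.
  set s : ℝ := √(ρ * b * (1 + ε ^ 2)) / δ with hs
  have hs2 : (s * δ) ^ 2 = ρ * b * (1 + ε ^ 2) := by
    rw [hs, div_mul_cancel₀ _ hδ, Real.sq_sqrt (by positivity)]
  have hA := pathMatrix_mem hji hil r s
  obtain ⟨X, hX, hXm⟩ := exists_pathMatrix_riccati hε hne hne' r s
  set M : PlantModel GP ε := scalarModel hε (pathMatrix j i l r s) hA with hM
  have hXj : X j ≤ b := by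
    rw [(hXm j).2, if_pos rfl, if_neg hne, add_zero, hb, ← mul_one_div]
    have : riccatiGain ε (X i) ≤ 1 / ε ^ 2 := by
      have := (hXm i).1
      rw [riccatiGain, div_le_div_iff₀ (by positivity) (by positivity)]
      linarith
    gcongr
  have hrow : Γ M i j =
      Γ (scalarModel hε (pathMatrix j i l r 0) (pathMatrix_mem hji hil r 0)) i j :=
    strategies_row_eq (i := i) (M := M) (M' := scalarModel hε _ (pathMatrix_mem hji hil r 0)) hC hΓ
      (fun m => by simp [hM, scalarModel, pathMatrix]) rfl rfl j
  set P : Plant GP ε := ⟨M, Pi.single j 1, 0⟩ with hP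
  have hxi : closedLoopState P (Γ M) 1 i = δ := by
    have hu : ∑ q, impulse (Γ M i q) 0 * P.x0 q = impulse (Γ M i j) 0 := by
      simp [hP, Pi.single_apply]
    rw [closedLoopState_succ, totalInput_zero, hu, hrow]
    simp only [hP, hM, scalarModel, closedLoopState_zero, pathMatrix_mulVec]
    simp [hδd, scalarModel]
  have hxl : closedLoopState P (Γ M) 2 l = s * δ + ε * totalInput P (Γ M) 1 l := by
    rw [closedLoopState_succ]
    simp only [hP, hM, scalarModel, pathMatrix_mulVec, if_neg hne'.symm, if_true,
      Matrix.diagonal_apply_eq] at hxi ⊢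
    rw [hxi]
  have hcost : ENNReal.ofReal (ρ * b) ≤ cost P (Γ M) := by
    refine le_trans (ENNReal.ofReal_le_ofReal ?_) (ofReal_sum_node_le_cost P (Γ M) 2 l)
    rw [Finset.sum_range_succ, Finset.sum_range_one, hxl]
    have h1 := sq_div_le_add_sq (ε := ε) (s * δ) (totalInput P (Γ M) 1 l)
    rw [hs2, mul_div_assoc, div_self (by positivity), mul_one] at h1
    have h2 := sq_nonneg (P.x0 l)
    have h3 := sq_nonneg (totalInput P (Γ M) 0 l)
    have h4 := sq_nonneg (closedLoopState P (Γ M) (0 + 1) l)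
    linarith
  have hβ : ∑ q, X q * (Pi.single j 1 : Fin n → ℝ) q ^ 2 +
      ∑ q, (1 + ε ^ 2 * X q) * (0 : Fin n → ℝ) q ^ 2 = X j := by
    simp [Pi.single_apply, ite_pow]
  have hXj1 := (hXm j).1
  refine le_trans (ENNReal.ofReal_le_ofReal ?_)
    (le_blindCompetitiveRatio_of_lt hε hPK hA hX _ _ hcost hβ (by linarith))
  rw [le_div_iff₀ (by linarith)]
  gcongr

lemma le_blindCompetitiveRatio (hε : 0 < ε) (hC : TotallyDisconnectedGraph GC)
    (hPK : GP ≤ GK) {Γ : Strategy GP ε} (hΓ : Γ ∈ strategies GP GK GC ε) {j i l : Fin n}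
    (hji : GP.Adj j i) (hil : GP.Adj i l) (hne : j ≠ i) (hne' : i ≠ l) :
    ENNReal.ofReal ((2 * ε ^ 2 + 1 + √(4 * ε ^ 2 + 1)) / (2 * ε ^ 2)) ≤
      blindCompetitiveRatio GK Γ := by
  set ρ := (2 * ε ^ 2 + 1 + √(4 * ε ^ 2 + 1)) / (2 * ε ^ 2) with hρ
  -- `y` is the positive root of `ε² y² = 1 + y`, and the claimed bound is `1 + y`.
  set y := (1 + √(4 * ε ^ 2 + 1)) / (2 * ε ^ 2) with hy
  have hy0 : 0 < y := by positivity
  have hρy : ρ = 1 + y := by rw [hρ, hy]; field_simp; ring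
  have hyeq : ε ^ 2 * y ^ 2 = 1 + y := by
    have := Real.sq_sqrt (show 0 ≤ 4 * ε ^ 2 + 1 by positivity)
    rw [hy]
    generalize √(4 * ε ^ 2 + 1) = S at this ⊢
    field_simp
    linear_combination this
  by_cases hdead : ∀ r, r + ε * impulse
      (Γ (scalarModel hε (pathMatrix j i l r 0) (pathMatrix_mem hji hil r 0)) i j) 0 = 0
  swap
  · push Not at hdead
    obtain ⟨r, hr⟩ := hdead
    exact le_blindCompetitiveRatio_of_not_deadbeat hε hC hPK hΓ hji hil hne hne' r hr ρ
      (by positivity)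
  -- The disturbance at `i` is `p * r`. This `p` maximises the quotient of `(p - 1 / ε) ^ 2 + ε ^ 2
  -- * p ^ 2` by `β`, and the maximum is `ρ`.
  set p : ℝ := -(1 / (ε * y * (1 + ε ^ 2))) with hp
  set β : ℝ := p ^ 2 * (1 + ε ^ 2) + 1 / (1 + ε ^ 2) with hβ
  have hβ0 : 0 < β := by positivity
  have hκ : (p - 1 / ε) ^ 2 + ε ^ 2 * p ^ 2 = ρ * β := by
    rw [hβ, hp, hρy]
    field_simp
    linear_combination (-(y * (1 + ε ^ 2))) * hyeq
  have hbound : ∀ r : ℝ, ENNReal.ofReal (r ^ 2 * (ρ * β) / (1 + r ^ 2 * β)) ≤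
      blindCompetitiveRatio GK Γ := by
    intro r
    have hA := pathMatrix_mem hji hil r 0
    obtain ⟨X, hX, hXm⟩ := exists_pathMatrix_riccati hε hne hne' r 0
    have hXi : X i = 1 := by rw [(hXm i).2]; simp [hne.symm]
    have hXj : X j = 1 + r ^ 2 / (1 + ε ^ 2) := by
      rw [(hXm j).2, hXi]; simp [hne, riccatiGain]; rfl
    set M : PlantModel GP ε := scalarModel hε (pathMatrix j i l r 0) hA with hM
    set P : Plant GP ε := ⟨M, Pi.single j 1, Pi.single i (p * r)⟩ with hP
    refine le_blindCompetitiveRatio_of_lt hε hPK hA hX (Pi.single j 1) (Pi.single i (p * r)) ?_ ?_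
      (by positivity)
    · refine le_trans (ENNReal.ofReal_le_ofReal ?_) (ofReal_sum_node_le_cost P (Γ M) 1 i)
      have hv : totalInput P (Γ M) 0 i = r * (p - 1 / ε) := by
        have h := hdead r
        rw [totalInput_zero]
        simp [hP, Pi.single_apply]
        field_simp
        linear_combination h
      have hx : closedLoopState P (Γ M) 1 i = r * (ε * p) := by
        rw [closedLoopState_succ, hv]
        simp only [hP, hM, scalarModel, closedLoopState_zero, pathMatrix_mulVec]
        simp
        field_simp
        ring
      rw [Finset.sum_range_one, hv, zero_add, hx, ← hκ]
      nlinarith [sq_nonneg (P.x0 i)]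
    · have h1 : ∑ q, X q * (Pi.single j 1 : Fin n → ℝ) q ^ 2 = X j := by
        simp [Pi.single_apply, ite_pow]
      have h2 : ∑ q, (1 + ε ^ 2 * X q) * (Pi.single i (p * r) : Fin n → ℝ) q ^ 2 =
          (1 + ε ^ 2 * X i) * (p * r) ^ 2 := by
        simp [Pi.single_apply, ite_pow]
      rw [h1, h2, hXi, hXj, hβ]
      ring
  -- The bounds tend to `ρ` as `r → ∞`. If the ratio were some `c < ρ`, the value of `r` chosen
  -- below would give `c + 1 ≤ c`.
  by_contra! hlt
  obtain ⟨c, hc⟩ : ∃ c : ℝ, c = (blindCompetitiveRatio GK Γ).toReal := ⟨_, rfl⟩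
  have hc0 : 0 ≤ c := hc ▸ ENNReal.toReal_nonneg
  have hcc : blindCompetitiveRatio GK Γ = ENNReal.ofReal c := by
    rw [hc, ENNReal.ofReal_toReal hlt.ne_top]
  rw [hcc, ENNReal.ofReal_lt_ofReal_iff (by positivity)] at hlt
  have hd : 0 < (ρ - c) * β := mul_pos (by linarith) hβ0
  have h := hbound (√((c + 1) / ((ρ - c) * β)))
  rw [hcc, ENNReal.ofReal_le_ofReal_iff hc0, Real.sq_sqrt (by positivity),
    div_le_iff₀ (by positivity)] at h
  have h1 : (c + 1) / ((ρ - c) * β) * ((ρ - c) * β) = c + 1 := div_mul_cancel₀ _ hd.ne'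
  nlinarith

/-! ### The gain at the sinks -/

/-- The diagonal entries of `F(A, B)`. -/
def nodeGain (M : PlantModel GP ε) (i : Fin n) : ℝ := sinkGain M i i

lemma sinkGain_eq (M : PlantModel GP ε) : sinkGain M = Matrix.diagonal (nodeGain M) := by
  have : (sinkGain M).IsDiag := Matrix.isDiag_diagonal _
  exact this.diagonal_diag.symm

lemma nodeGain_of_not_isSink (M : PlantModel GP ε) {i : Fin n} (h : ¬ IsSink GP i) :
    nodeGain M i = 0 := by
  simp [nodeGain, sinkGain, h]

lemma nodeGain_congr {M M' : PlantModel GP ε} {i : Fin n} (hA : M.A i i = M'.A i i)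
    (hB : M.B i i = M'.B i i) : nodeGain M i = nodeGain M' i := by
  simp [nodeGain, sinkGain, hA, hB]

lemma nodeGain_nonneg (M : PlantModel GP ε) (i : Fin n) : 0 ≤ nodeGain M i := by
  simp only [nodeGain, sinkGain, Matrix.diagonal_apply_eq]
  split_ifs <;> positivity

lemma nodeGain_le_one (M : PlantModel GP ε) (i : Fin n) : nodeGain M i ≤ 1 := by
  simp only [nodeGain, sinkGain, Matrix.diagonal_apply_eq]
  split_ifs
  · rw [div_le_one (by positivity)]
    have : 1 - M.A i i ^ 2 ≤
        √((M.A i i ^ 2 + M.B i i ^ 2) ^ 2 + 2 * (M.B i i ^ 2 - M.A i i ^ 2) + 1) := by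
      refine Real.le_sqrt_of_sq_le ?_
      nlinarith [sq_nonneg (M.A i i * M.B i i), sq_nonneg (M.B i i ^ 2), sq_nonneg (M.B i i)]
    nlinarith [sq_nonneg (M.B i i)]
  · exact zero_le_one

lemma nodeGain_pos (M : PlantModel GP ε) {i : Fin n} (h : IsSink GP i) : 0 < nodeGain M i := by
  simp only [nodeGain, sinkGain, Matrix.diagonal_apply_eq, if_pos h]
  positivity

/-- This is the scalar Riccati equation `X = 1 + a² X / (1 + b² X)` in the variable `f = 1 / (1 + b²
X)`, where `X = 1 + (1 - f) a² / b²`. -/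
lemma nodeGain_eq (M : PlantModel GP ε) {i : Fin n} (h : IsSink GP i) :
    nodeGain M i * (M.B i i ^ 2 + (1 - nodeGain M i) * M.A i i ^ 2) = 1 - nodeGain M i := by
  simp only [nodeGain, sinkGain, Matrix.diagonal_apply_eq, if_pos h]
  generalize M.A i i = a
  generalize M.B i i = b
  have hS : 0 ≤ (a ^ 2 + b ^ 2) ^ 2 + 2 * (b ^ 2 - a ^ 2) + 1 := by
    nlinarith [sq_nonneg (a * b), sq_nonneg (b ^ 2), sq_nonneg b, sq_nonneg (a ^ 2 - 1)]
  have hsq := Real.sq_sqrt hS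
  have h0 : b ^ 2 + a ^ 2 + 1 + √((a ^ 2 + b ^ 2) ^ 2 + 2 * (b ^ 2 - a ^ 2) + 1) ≠ 0 := by
    positivity
  generalize √((a ^ 2 + b ^ 2) ^ 2 + 2 * (b ^ 2 - a ^ 2) + 1) = S at hsq h0
  field_simp
  linear_combination -hsq

/-- Completion of the square for one step at a sink. -/
lemma sink_step {a b f : ℝ} (hb : b ≠ 0) (hf : f ≠ 0)
    (h : f * (b ^ 2 + (1 - f) * a ^ 2) = 1 - f) (y v : ℝ) :
    v ^ 2 + (y + b * v) ^ 2 + (1 - f) / b ^ 2 * (a * (y + b * v)) ^ 2 =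
      (1 - f) / b ^ 2 * y ^ 2 + f⁻¹ * (v - b⁻¹ * (f - 1) * y) ^ 2 := by
  have h1 : (1 - f) * a ^ 2 = (1 - f) / f - b ^ 2 := by
    field_simp
    linear_combination h
  have h2 : (1 - f) / b ^ 2 * (a * (y + b * v)) ^ 2 =
      ((1 - f) * a ^ 2) * (y + b * v) ^ 2 / b ^ 2 := by ring
  rw [h2, h1]
  field_simp
  ring

/-! ### The transfer function of `Γ^Θ` -/

/-- The direct feedthrough of `Γ^Θ`. -/
def thetaFeed (M : PlantModel GP ε) (i l : Fin n) : ℝ :=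
  (M.B i i)⁻¹ * (nodeGain M i - 1) * M.A i l - if i = l then (M.B i i)⁻¹ * M.D i i else 0

/-- The input matrix of the realization of `Γ^Θ`. -/
def thetaIn (M : PlantModel GP ε) (i l : Fin n) : ℝ :=
  (M.B i i)⁻¹ * M.D i i * nodeGain M i * M.A i l -
    if i = l then (M.B i i)⁻¹ * M.D i i ^ 2 else 0

lemma strategyTheta_apply (hε : 0 < ε) (M : PlantModel GP ε) (i l : Fin n) :
    strategyTheta GP ε M i l =
      RatFunc.C (thetaIn M i l) / (RatFunc.X - RatFunc.C (M.D i i)) +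
        RatFunc.C (thetaFeed M i l) := by
  have hBinv : M.B⁻¹ = Matrix.diagonal fun i => (M.B i i)⁻¹ := by
    refine Matrix.inv_eq_right_inv ?_
    conv_lhs => rw [M.B_eq]
    rw [Matrix.diagonal_mul_diagonal, ← Matrix.diagonal_one]
    congr 1
    ext i
    simpa using mul_inv_cancel₀ (M.B_ne_zero hε i)
  have hres : ((RatFunc.X : RatFunc ℝ) • (1 : Matrix (Fin n) (Fin n) (RatFunc ℝ)) -
      M.D.map (RatFunc.C (K := ℝ)))⁻¹ =
      Matrix.diagonal fun i => (RatFunc.X - RatFunc.C (M.D i i))⁻¹ := by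
    refine Matrix.inv_eq_right_inv ?_
    conv_lhs => rw [M.D_eq]
    rw [Matrix.diagonal_map (map_zero _), Matrix.smul_one_eq_diagonal, Matrix.diagonal_sub,
      Matrix.diagonal_mul_diagonal, ← Matrix.diagonal_one]
    congr 1
    ext i
    simp only [Matrix.diagonal_apply_eq]
    refine mul_inv_cancel₀ ?_
    have : (RatFunc.X - RatFunc.C (M.D i i) : RatFunc ℝ) =
        algebraMap (Polynomial ℝ) (RatFunc ℝ) (Polynomial.X - Polynomial.C (M.D i i)) := by simp
    rw [this]
    exact RatFunc.algebraMap_ne_zero (Polynomial.X_sub_C_ne_zero _)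
  have hin : (M.B⁻¹ * M.D * sinkGain M * M.A - M.B⁻¹ * M.D ^ 2) i l = thetaIn M i l := by
    rw [hBinv, sinkGain_eq, M.D_eq, Matrix.diagonal_pow, Matrix.sub_apply,
      Matrix.diagonal_mul_diagonal, Matrix.diagonal_mul_diagonal, Matrix.diagonal_mul,
      Matrix.diagonal_mul_diagonal, Matrix.diagonal_apply]
    simp [thetaIn]
  have hfeed : (M.B⁻¹ * (sinkGain M - 1) * M.A - M.B⁻¹ * M.D) i l = thetaFeed M i l := by
    rw [hBinv, sinkGain_eq, M.D_eq, ← Matrix.diagonal_one, Matrix.diagonal_sub, Matrix.sub_apply,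
      Matrix.diagonal_mul_diagonal, Matrix.diagonal_mul, Matrix.diagonal_mul_diagonal,
      Matrix.diagonal_apply]
    simp [thetaFeed]
  rw [strategyTheta, transferMatrix, hres, Matrix.map_one _ (map_zero _) (map_one _),
    Matrix.one_mul, Matrix.add_apply, Matrix.diagonal_mul, Matrix.map_apply, Matrix.map_apply,
    hin, hfeed, div_eq_inv_mul]

lemma impulse_strategyTheta (hε : 0 < ε) (M : PlantModel GP ε) (i l : Fin n) (k : ℕ) :
    impulse (strategyTheta GP ε M i l) k =
      if k = 0 then thetaFeed M i l else thetaIn M i l * M.D i i ^ (k - 1) := by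
  rw [strategyTheta_apply hε, impulse_first_order]

lemma strategyTheta_mem (hε : 0 < ε) (hK : HasAllLoops GK) (hCl : HasAllLoops GC)
    (hPK : GP ≤ GK) : strategyTheta GP ε ∈ strategies GP GK GC ε := by
  refine ⟨fun M => ⟨fun i j => ?_, fun i j hij => ?_⟩, fun i M M' h l => ?_⟩
  · rw [strategyTheta_apply hε]
    exact intDegree_first_order_le _ _ _
  · have hadj : ¬ GK.Adj j i := fun hadj => by simp [adjacency, hadj] at hij
    have hne := adj_self_of_hasAllLoops hK hadj
    have hA : M.A i j = 0 := M.A_eq_zero fun h => hadj (hPK h)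
    simp [strategyTheta_apply hε, thetaIn, thetaFeed, hA, hne]
  · obtain ⟨hA, hB, hD⟩ := h i (by simp [adjacency, hCl i])
    rw [strategyTheta_apply hε, strategyTheta_apply hε]
    simp only [thetaIn, thetaFeed, nodeGain_congr (hA i) hB, hA, hB, hD]

/-! ### The response of `Γ^Θ` -/

lemma sum_thetaFeed (M : PlantModel GP ε) (i : Fin n) (x : Fin n → ℝ) :
    ∑ l, thetaFeed M i l * x l =
      (M.B i i)⁻¹ * (nodeGain M i - 1) * M.A.mulVec x i - (M.B i i)⁻¹ * M.D i i * x i := by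
  simp only [thetaFeed, sub_mul, Finset.sum_sub_distrib, ite_mul, zero_mul, Finset.sum_ite_eq,
    Finset.mem_univ, if_true, Matrix.mulVec, dotProduct, Finset.mul_sum]
  simp only [mul_assoc, sub_mul]

lemma sum_thetaIn (M : PlantModel GP ε) (i : Fin n) (x : Fin n → ℝ) :
    ∑ l, thetaIn M i l * x l =
      (M.B i i)⁻¹ * M.D i i * nodeGain M i * M.A.mulVec x i -
        (M.B i i)⁻¹ * M.D i i ^ 2 * x i := by
  simp only [thetaIn, sub_mul, Finset.sum_sub_distrib, ite_mul, zero_mul, Finset.sum_ite_eq,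
    Finset.mem_univ, if_true, Matrix.mulVec, dotProduct, Finset.mul_sum]
  simp only [mul_assoc]

/-- The controller `Γ^Θ` knows the disturbance from time one on. -/
lemma rowResponse_strategyTheta (hε : 0 < ε) (M : PlantModel GP ε) (i : Fin n)
    (x : ℕ → Fin n → ℝ) (w : ℝ) (k : ℕ)
    (hx : ∀ m < k, x (m + 1) i = M.A.mulVec (x m) i +
      M.B i i * (rowResponse (strategyTheta GP ε M i) x m + M.D i i ^ m * w)) :
    rowResponse (strategyTheta GP ε M i) x k =
      (M.B i i)⁻¹ * (nodeGain M i - 1) * M.A.mulVec (x k) i -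
        if k = 0 then (M.B i i)⁻¹ * M.D i i * x 0 i else M.D i i ^ k * w := by
  have hb := M.B_ne_zero hε i
  -- `c` is the `i`-th component of the controller state of the realization of `Γ^Θ`.
  set c : ℕ → ℝ := fun k => ∑ m ∈ Finset.range k,
    (∑ l, thetaIn M i l * x m l) * M.D i i ^ (k - m - 1) with hc
  have hcs : ∀ k, c (k + 1) = M.D i i * c k + ∑ l, thetaIn M i l * x k l := by
    intro k
    simp only [hc, Finset.sum_range_succ, Finset.mul_sum]
    congr 1
    · refine Finset.sum_congr rfl fun m hm => ?_
      have : k + 1 - m - 1 = (k - m - 1) + 1 := by have := Finset.mem_range.1 hm; omega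
      rw [this, pow_succ]
      ring
    · simp
  have hr : ∀ k, rowResponse (strategyTheta GP ε M i) x k =
      ∑ l, thetaFeed M i l * x k l + c k := by
    intro k
    rw [rowResponse, Finset.sum_range_succ, add_comm]
    congr 1
    · simp [impulse_strategyTheta hε]
    · refine Finset.sum_congr rfl fun m hm => ?_
      have : k - m ≠ 0 := by have := Finset.mem_range.1 hm; omega
      rw [Finset.sum_mul]
      refine Finset.sum_congr rfl fun l _ => ?_
      rw [impulse_strategyTheta hε, if_neg this]
      ring
  -- The controller state is a deadbeat observer: from time one on its error is exactly the current
  -- disturbance, so that adding `w` to `u` leaves pure state feedback.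
  have key : ∀ m ≤ k, c m = (M.B i i)⁻¹ * M.D i i * x m i -
      if m = 0 then (M.B i i)⁻¹ * M.D i i * x 0 i else M.D i i ^ m * w := by
    intro m
    induction m with
    | zero => intro _; simp [hc]
    | succ m ih =>
      intro hm
      have ihm := ih (by omega)
      rw [hcs, sum_thetaIn, hx m (by omega), hr, sum_thetaFeed, ihm, if_neg (Nat.succ_ne_zero m)]
      split_ifs with h0
      · subst h0
        field_simp
        ring
      · field_simp
        ring
  rw [hr, sum_thetaFeed, key k le_rfl]
  ring

/-- The controller `K` agrees with `Γ^Θ` in row `i` up to time `k`. -/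
def AgreesBefore (M : PlantModel GP ε) (K : RatMatrix n) (i : Fin n) (k : ℕ) : Prop :=
  ∀ m < k, ∀ l, impulse (K i l) m = impulse (strategyTheta GP ε M i l) m

/-- In the convolution at time `k`, the coefficient with index `k` meets only `x 0`. Along the
trajectory of `K` itself, the input therefore differs from the law of `Γ^Θ` only by that term. -/
lemma totalInput_of_agreesBefore (hε : 0 < ε) (P : Plant GP ε) (K : RatMatrix n) (i : Fin n)
    (k : ℕ) (h : AgreesBefore P.model K i k) :
    totalInput P K k i =
      (P.model.B i i)⁻¹ * (nodeGain P.model i - 1) *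
          P.model.A.mulVec (closedLoopState P K k) i +
        (if k = 0 then P.w0 i - (P.model.B i i)⁻¹ * P.model.D i i * P.x0 i else 0) +
        ∑ l, (impulse (K i l) k - impulse (strategyTheta GP ε P.model i l) k) * P.x0 l := by
  have hlt : ∀ m < k, rowResponse (K i) (closedLoopState P K) m =
      rowResponse (strategyTheta GP ε P.model i) (closedLoopState P K) m := by
    intro m hm
    refine Finset.sum_congr rfl fun q _ => Finset.sum_congr rfl fun l _ => ?_
    rw [h (m - q) (by omega)]
  have hk : rowResponse (K i) (closedLoopState P K) k =
      rowResponse (strategyTheta GP ε P.model i) (closedLoopState P K) k +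
        ∑ l, (impulse (K i l) k - impulse (strategyTheta GP ε P.model i l) k) * P.x0 l := by
    rw [rowResponse, rowResponse, Finset.sum_range_succ', Finset.sum_range_succ', add_assoc]
    congr 1
    · refine Finset.sum_congr rfl fun q hq => Finset.sum_congr rfl fun l _ => ?_
      have := Finset.mem_range.1 hq
      rw [h (k - (q + 1)) (by omega)]
    · rw [← Finset.sum_add_distrib]
      refine Finset.sum_congr rfl fun l _ => ?_
      rw [closedLoopState_zero, Nat.sub_zero]
      ring
  rw [totalInput_eq, hk, rowResponse_strategyTheta hε P.model i (closedLoopState P K) (P.w0 i) k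
    fun m hm => by rw [closedLoopState_succ, totalInput_eq, hlt m hm]]
  rw [closedLoopState_zero]
  split_ifs with h0
  · subst h0; ring
  · ring

lemma closedLoopState_of_agreesBefore (hε : 0 < ε) (P : Plant GP ε) (K : RatMatrix n) (i : Fin n)
    (hi : ¬ IsSink GP i) (k : ℕ) (h : AgreesBefore P.model K i k)
    (hw : k = 0 → P.w0 i = (P.model.B i i)⁻¹ * P.model.D i i * P.x0 i) :
    closedLoopState P K (k + 1) i = P.model.B i i *
      ∑ l, (impulse (K i l) k - impulse (strategyTheta GP ε P.model i l) k) * P.x0 l := by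
  have hb := P.model.B_ne_zero hε i
  have h0 : (if k = 0 then P.w0 i - (P.model.B i i)⁻¹ * P.model.D i i * P.x0 i else 0) = 0 := by
    split_ifs with hk
    · rw [hw hk, sub_self]
    · rfl
  rw [closedLoopState_succ, totalInput_of_agreesBefore hε P K i k h, h0,
    nodeGain_of_not_isSink _ hi]
  field_simp
  ring

/-! ### The value function of `Γ^Θ` -/

/-- The cost of `Γ^Θ` from a state that carries no information about the disturbance that the
controller does not have. -/
def thetaValue (M : PlantModel GP ε) (x : Fin n → ℝ) : ℝ :=
  ∑ i, (x i ^ 2 + (1 - nodeGain M i) / M.B i i ^ 2 * M.A.mulVec x i ^ 2)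

lemma thetaValue_nonneg (M : PlantModel GP ε) (x : Fin n → ℝ) : 0 ≤ thetaValue M x := by
  refine Finset.sum_nonneg fun i _ => ?_
  have := sub_nonneg.2 (nodeGain_le_one M i)
  positivity

/-- Sinks act on no other node, so with the nonsinks at zero all coupling disappears. -/
lemma mulVec_of_eq_zero_nonsink (M : PlantModel GP ε) {x : Fin n → ℝ}
    (hx : ∀ j, ¬ IsSink GP j → x j = 0) (i : Fin n) : M.A.mulVec x i = M.A i i * x i := by
  rw [Matrix.mulVec, dotProduct]
  refine Finset.sum_eq_single i (fun j _ hj => ?_) fun h => absurd (Finset.mem_univ i) h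
  by_cases hs : IsSink GP j
  · rw [M.A_eq_zero (hs i hj.symm), zero_mul]
  · rw [hx j hs, mul_zero]

/-- The controller `K` agrees with `Γ^Θ` at the nodes that are not sinks. -/
def AgreesNonsink (M : PlantModel GP ε) (K : RatMatrix n) : Prop :=
  ∀ i, ¬ IsSink GP i → ∀ k, AgreesBefore M K i k

/-- The next state vanishes at the nonsinks, so the value function splits over the nodes. A sink
contributes the completed square of `sink_step`; at a nonsink the input is the deadbeat one and its
square vanishes. At time zero this needs the matched disturbance. -/
lemma stageCost_add_thetaValue (hε : 0 < ε) (P : Plant GP ε) (K : RatMatrix n)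
    (hK : AgreesNonsink P.model K) (k : ℕ)
    (hw : k = 0 → ∀ i, P.w0 i = (P.model.B i i)⁻¹ * P.model.D i i * P.x0 i) :
    stageCost P K k + thetaValue P.model (closedLoopState P K (k + 1)) =
      thetaValue P.model (closedLoopState P K k) + ∑ i, (nodeGain P.model i)⁻¹ *
        (totalInput P K k i - (P.model.B i i)⁻¹ * (nodeGain P.model i - 1) *
          P.model.A.mulVec (closedLoopState P K k) i) ^ 2 := by
  have hagree : ∀ i, ¬ IsSink GP i → ∀ l,
      impulse (K i l) k - impulse (strategyTheta GP ε P.model i l) k = 0 := fun i hi l =>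
    sub_eq_zero.2 (hK i hi (k + 1) k (Nat.lt_succ_self k) l)
  have hx : ∀ i, ¬ IsSink GP i → closedLoopState P K (k + 1) i = 0 := by
    intro i hi
    rw [closedLoopState_of_agreesBefore hε P K i hi k (hK i hi k) fun hk => hw hk i]
    simp [hagree i hi]
  rw [stageCost, thetaValue, thetaValue, ← Finset.sum_add_distrib, ← Finset.sum_add_distrib]
  refine Finset.sum_congr rfl fun i _ => ?_
  rw [mulVec_of_eq_zero_nonsink P.model hx]
  have hb := P.model.B_ne_zero hε i
  by_cases hi : IsSink GP i
  · have := sink_step hb (nodeGain_pos P.model hi).ne' (nodeGain_eq P.model hi)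
      (P.model.A.mulVec (closedLoopState P K k) i) (totalInput P K k i)
    rw [closedLoopState_succ]
    linear_combination this
  · have h0 : (if k = 0 then P.w0 i - (P.model.B i i)⁻¹ * P.model.D i i * P.x0 i else 0) = 0 := by
      split_ifs with hk
      · rw [hw hk i, sub_self]
      · rfl
    rw [hx i hi, totalInput_of_agreesBefore hε P K i k (hK i hi k), h0,
      nodeGain_of_not_isSink _ hi]
    simp only [hagree i hi]
    field_simp
    simp

lemma agreesNonsink_strategyTheta (M : PlantModel GP ε) :
    AgreesNonsink M (strategyTheta GP ε M) := fun _ _ _ _ _ _ => rfl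

lemma cost_strategyTheta_le (hε : 0 < ε) (P : Plant GP ε) :
    cost P (strategyTheta GP ε P.model) ≤
      ENNReal.ofReal (stageCost P (strategyTheta GP ε P.model) 0 +
        thetaValue P.model (closedLoopState P (strategyTheta GP ε P.model) 1)) := by
  refine cost_le_of_potential P _ _ (thetaValue_nonneg _) fun k hk => ?_
  rw [stageCost_add_thetaValue hε P _ (agreesNonsink_strategyTheta _) k (by omega)]
  refine (add_eq_left.2 (Finset.sum_eq_zero fun i _ => ?_)).le
  rw [totalInput_of_agreesBefore hε P _ i k fun _ _ _ => rfl]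
  simp only [if_neg (by omega : k ≠ 0)]
  simp

lemma le_cost_of_agreesNonsink (hε : 0 < ε) (P : Plant GP ε) (K : RatMatrix n)
    (hK : AgreesNonsink P.model K) :
    ENNReal.ofReal (stageCost P K 0 + thetaValue P.model (closedLoopState P K 1)) ≤ cost P K := by
  refine le_cost_of_potential P K _ ?_ (by simp [thetaValue]) fun k hk => ?_
  · unfold thetaValue Matrix.mulVec dotProduct
    fun_prop
  · rw [stageCost_add_thetaValue hε P _ hK k (by omega)]
    exact le_add_of_nonneg_right (Finset.sum_nonneg fun i _ =>
      mul_nonneg (inv_nonneg.2 (nodeGain_nonneg _ _)) (sq_nonneg _))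

/-- The plant whose initial disturbance is the one that `Γ^Θ` expects. -/
def matchedPlant (M : PlantModel GP ε) (x0 : Fin n → ℝ) : Plant GP ε :=
  ⟨M, x0, fun i => (M.B i i)⁻¹ * M.D i i * x0 i⟩

lemma cost_matchedPlant_le (hε : 0 < ε) (M : PlantModel GP ε) (x0 : Fin n → ℝ) :
    cost (matchedPlant M x0) (strategyTheta GP ε M) ≤ ENNReal.ofReal (thetaValue M x0) := by
  refine (cost_strategyTheta_le hε (matchedPlant M x0)).trans (le_of_eq ?_)
  congr 1
  rw [stageCost_add_thetaValue hε (matchedPlant M x0) _ (agreesNonsink_strategyTheta _) 0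
    fun _ _ => rfl, closedLoopState_zero]
  refine add_eq_left.2 (Finset.sum_eq_zero fun i _ => ?_)
  rw [totalInput_of_agreesBefore hε (matchedPlant M x0) _ i 0 fun _ _ _ => rfl]
  simp [matchedPlant]

/-! ### Strategies that are nowhere worse than `Γ^Θ` -/

/-- The model that keeps the data of the node `i` of `M`, has the entry `s` at `(l, i)` and no
other interconnection. -/
def probeModel (M : PlantModel GP ε) {i l : Fin n} (hil : GP.Adj i l) (s : ℝ) :
    PlantModel GP ε where
  A := fun q m => if q = i then M.A i m else if q = l ∧ m = i then s else 0
  B := Matrix.diagonal fun q => if q = i then M.B i i else ε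
  D := Matrix.diagonal fun q => if q = i then M.D i i else 0
  memA := mem_stateMatrices fun q m h => by
    split_ifs at h with h1 h2
    · subst h1
      by_contra hadj
      exact h (M.A_eq_zero hadj)
    · rw [h2.1, h2.2]
      exact hil
    · exact absurd rfl h
  memB := (mem_inputMatrices_iff _).2 ⟨Matrix.isDiag_diagonal _, fun q => by
    rw [Matrix.diagonal_apply_eq]
    split_ifs
    · exact ((mem_inputMatrices_iff M.B).1 M.memB).2 i
    · exact le_abs_self ε⟩
  memD := Matrix.isDiag_diagonal _

section probe

variable (M : PlantModel GP ε) {i l : Fin n} (hil : GP.Adj i l) (s : ℝ)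

lemma probeModel_A_self (m : Fin n) : (probeModel M hil s).A i m = M.A i m := by
  simp [probeModel]

lemma probeModel_B_self : (probeModel M hil s).B i i = M.B i i := by simp [probeModel]

lemma probeModel_D_self : (probeModel M hil s).D i i = M.D i i := by simp [probeModel]

lemma probeModel_B_of_ne {q : Fin n} (hq : q ≠ i) : (probeModel M hil s).B q q = ε := by
  simp [probeModel, hq]

lemma probeModel_D_of_ne {q : Fin n} (hq : q ≠ i) : (probeModel M hil s).D q q = 0 := by
  simp [probeModel, hq]

lemma probeModel_A_target (hne : l ≠ i) (m : Fin n) :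
    (probeModel M hil s).A l m = if m = i then s else 0 := by
  simp [probeModel, hne]

lemma probeModel_mulVec_target (hne : l ≠ i) (x : Fin n → ℝ) :
    (probeModel M hil s).A.mulVec x l = s * x i := by
  simp [Matrix.mulVec, dotProduct, probeModel_A_target M hil s hne]

lemma probeModel_mulVec_other {q : Fin n} (hqi : q ≠ i) (hql : q ≠ l) (x : Fin n → ℝ) :
    (probeModel M hil s).A.mulVec x q = 0 := by
  simp [Matrix.mulVec, dotProduct, probeModel, hqi, hql]

lemma strategy_probeModel (hC : TotallyDisconnectedGraph GC) {Γ : Strategy GP ε}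
    (hΓ : Γ ∈ strategies GP GK GC ε) (m : Fin n) :
    Γ (probeModel M hil s) i m = Γ M i m :=
  strategies_row_eq hC hΓ (probeModel_A_self M hil s) (probeModel_B_self M hil s)
    (probeModel_D_self M hil s) m

lemma thetaValue_probeModel (hne : l ≠ i) (x : Fin n → ℝ) :
    thetaValue (probeModel M hil s) x = ∑ q, x q ^ 2 +
      (1 - nodeGain M i) / M.B i i ^ 2 * M.A.mulVec x i ^ 2 +
      (1 - nodeGain (probeModel M hil s) l) / ε ^ 2 * (s * x i) ^ 2 := by
  rw [thetaValue, Finset.sum_add_distrib, add_assoc, add_right_inj]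
  rw [Finset.sum_eq_add i l hne.symm
    (fun q _ hq => by rw [probeModel_mulVec_other M hil s hq.1 hq.2]; ring)
    (fun h => absurd (Finset.mem_univ _) h) (fun h => absurd (Finset.mem_univ _) h),
    probeModel_mulVec_target M hil s hne, probeModel_B_of_ne M hil s hne,
    probeModel_B_self, nodeGain_congr (probeModel_A_self M hil s i)
      (probeModel_B_self M hil s)]
  congr 3
  simp [Matrix.mulVec, dotProduct, probeModel_A_self]

end probe

/-- If `Γ` is nowhere worse than `Γ^Θ` and agrees with it before time `k` at a node from which an
edge leaves, then both agree at time `k`: a difference would be amplified along the edge. -/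
lemma impulse_eq_of_probe (hε : 0 < ε) (hC : TotallyDisconnectedGraph GC) {Γ : Strategy GP ε}
    (hΓ : Γ ∈ strategies GP GK GC ε) (hΘ : strategyTheta GP ε ∈ strategies GP GK GC ε)
    (hdom : ∀ P : Plant GP ε, cost P (Γ P.model) ≤ cost P (strategyTheta GP ε P.model))
    (M : PlantModel GP ε) {i l : Fin n} (hi : ¬ IsSink GP i) (hil : GP.Adj i l) (hne : l ≠ i)
    (k : ℕ) (j : Fin n) (hagree : AgreesBefore M (Γ M) i k)
    (hl : ∀ s, (1 - nodeGain (probeModel M hil s) l) / ε ^ 2 *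
        (s * (Pi.single j 1 : Fin n → ℝ) i) ^ 2 ≤
      totalInput (matchedPlant (probeModel M hil s) (Pi.single j 1))
          (Γ (probeModel M hil s)) 0 l ^ 2 +
        closedLoopState (matchedPlant (probeModel M hil s) (Pi.single j 1))
          (Γ (probeModel M hil s)) 1 l ^ 2) :
    impulse (Γ M i j) k = impulse (strategyTheta GP ε M i j) k := by
  by_contra hτ
  have hb := M.B_ne_zero hε i
  set δ : ℝ := M.B i i * (impulse (Γ M i j) k - impulse (strategyTheta GP ε M i j) k) with hδ
  have hδ0 : δ ≠ 0 := mul_ne_zero hb (sub_ne_zero.2 hτ)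
  set x0 : Fin n → ℝ := Pi.single j 1 with hx0
  -- `c` is the part of the cost bound for `Γ^Θ` that does not involve `s`; the `s` below makes the
  -- amplified difference cost at least `c + 1`.
  set c : ℝ := ∑ q, x0 q ^ 2 + (1 - nodeGain M i) / M.B i i ^ 2 * M.A.mulVec x0 i ^ 2 with hc
  have hc0 : 0 ≤ c := by
    have := sub_nonneg.2 (nodeGain_le_one M i)
    exact add_nonneg (Finset.sum_nonneg fun _ _ => sq_nonneg _) (by positivity)
  set s : ℝ := √((c + 1) * (1 + ε ^ 2)) / δ with hs
  have hs2 : (s * δ) ^ 2 = (c + 1) * (1 + ε ^ 2) := by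
    rw [hs, div_mul_cancel₀ _ hδ0, Real.sq_sqrt (by positivity)]
  set M' := probeModel M hil s with hM'
  set P := matchedPlant M' x0 with hP
  have hagree' : AgreesBefore M' (Γ M') i k := fun m hm q => by
    rw [strategy_probeModel M hil s hC hΓ, strategy_probeModel M hil s hC hΘ]
    exact hagree m hm q
  have hxi : closedLoopState P (Γ M') (k + 1) i = δ := by
    rw [closedLoopState_of_agreesBefore hε P (Γ M') i hi k hagree' fun _ => rfl]
    have : ∀ q, (impulse (Γ M' i q) k - impulse (strategyTheta GP ε M' i q) k) =
        impulse (Γ M i q) k - impulse (strategyTheta GP ε M i q) k := fun q => by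
      rw [strategy_probeModel M hil s hC hΓ, strategy_probeModel M hil s hC hΘ]
    simp only [hP, matchedPlant, this]
    rw [probeModel_B_self]
    simp [hx0, Pi.single_apply, hδ]
  have hxl : closedLoopState P (Γ M') (k + 2) l = s * δ + ε * totalInput P (Γ M') (k + 1) l := by
    rw [closedLoopState_succ, ← hxi]
    simp only [hP, matchedPlant]
    rw [probeModel_mulVec_target M hil s hne, probeModel_B_of_ne M hil s hne]
  have hΓcost := (ofReal_sum_node_le_cost P (Γ M') (k + 2) l).trans
    ((hdom P).trans (cost_matchedPlant_le hε M' x0))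
  -- The stages of node `l` are split into the first, which `hl` compares with the `s`-dependent
  -- cost of `Γ^Θ`, the last, which carries the amplified difference, and the rest.
  rw [ENNReal.ofReal_le_ofReal_iff (thetaValue_nonneg _ _),
    thetaValue_probeModel M hil s hne, ← hc, Finset.sum_range_succ,
    Finset.sum_range_succ', hxl] at hΓcost
  have h1 := sq_div_le_add_sq (ε := ε) (s * δ) (totalInput P (Γ M') (k + 1) l)
  rw [hs2, mul_div_assoc, div_self (by positivity), mul_one] at h1
  have h2 := hl s
  have h3 := sq_nonneg (P.x0 l)
  have h4 : 0 ≤ ∑ m ∈ Finset.range k, (totalInput P (Γ M') (m + 1) l ^ 2 +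
      closedLoopState P (Γ M') (m + 1 + 1) l ^ 2) := Finset.sum_nonneg fun _ _ => by positivity
  simp only [zero_add] at hΓcost
  linarith

lemma exists_adj_of_not_isSink {i : Fin n} (hi : ¬ IsSink GP i) : ∃ l, l ≠ i ∧ GP.Adj i l := by
  simpa [IsSink] using hi

/-- A strategy that is nowhere worse than `Γ^Θ` agrees with it at the nodes that are not sinks. -/
lemma agreesNonsink_of_le (hε : 0 < ε) (hC : TotallyDisconnectedGraph GC) {Γ : Strategy GP ε}
    (hΓ : Γ ∈ strategies GP GK GC ε) (hΘ : strategyTheta GP ε ∈ strategies GP GK GC ε)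
    (hdom : ∀ P : Plant GP ε, cost P (Γ P.model) ≤ cost P (strategyTheta GP ε P.model))
    (M : PlantModel GP ε) : AgreesNonsink M (Γ M) := by
  -- For `j ≠ i` the initial state is zero at `i`, so `Γ^Θ` pays nothing that depends on `s`. This
  -- case comes first because the case `j = i` needs it at the node `l`.
  have hoff : ∀ (M : PlantModel GP ε) (i j : Fin n), ¬ IsSink GP i → j ≠ i →
      impulse (Γ M i j) 0 = impulse (strategyTheta GP ε M i j) 0 := by
    intro M i j hi hj
    obtain ⟨l, hne, hil⟩ := exists_adj_of_not_isSink hi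
    refine impulse_eq_of_probe hε hC hΓ hΘ hdom M hi hil hne 0 j (fun m hm => by omega) fun s => ?_
    rw [Pi.single_eq_of_ne hj.symm]
    simp only [mul_zero, ne_eq, OfNat.ofNat_ne_zero, not_false_eq_true, zero_pow]
    positivity
  intro i hi k
  obtain ⟨l, hne, hil⟩ := exists_adj_of_not_isSink hi
  induction k with
  | zero => intro m hm; omega
  | succ k ih =>
    intro m hm j
    rcases Nat.lt_succ_iff_lt_or_eq.1 hm with hlt | rfl
    · exact ih m hlt j
    refine impulse_eq_of_probe hε hC hΓ hΘ hdom M hi hil hne m j ih fun s => ?_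
    by_cases hj : j = i
    swap
    · rw [Pi.single_eq_of_ne (Ne.symm hj)]
      simp only [mul_zero, ne_eq, OfNat.ofNat_ne_zero, not_false_eq_true, zero_pow]
      positivity
    -- Now `Γ^Θ` also pays for `s`, and `Γ` must be shown to pay at least as much at node `l` in the
    -- first step. At a sink this is optimality of the gain with `a = 0`; at a nonsink `hoff` forces
    -- the deadbeat input `-s / ε`.
    subst hj
    set M' := probeModel M hil s with hM'
    have hy : M'.A.mulVec (Pi.single j 1 : Fin n → ℝ) l = s * (Pi.single j 1 : Fin n → ℝ) j :=
      probeModel_mulVec_target M hil s hne _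
    rw [closedLoopState_succ, closedLoopState_zero]
    simp only [matchedPlant]
    rw [hy, probeModel_B_of_ne M hil s hne]
    by_cases hls : IsSink GP l
    · have h := sink_step (M'.B_ne_zero hε l) (nodeGain_pos M' hls).ne' (nodeGain_eq M' hls)
        (s * (Pi.single j 1 : Fin n → ℝ) j)
        (totalInput (matchedPlant M' (Pi.single j 1)) (Γ M') 0 l)
      rw [probeModel_A_target M hil s hne, if_neg hne,
        probeModel_B_of_ne M hil s hne] at h
      have h2 : 0 ≤ (nodeGain M' l)⁻¹ :=
        inv_nonneg.2 (nodeGain_nonneg M' l)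
      have h3 := mul_nonneg h2 (sq_nonneg
        (totalInput (matchedPlant M' (Pi.single j 1)) (Γ M') 0 l -
          ε⁻¹ * (nodeGain M' l - 1) * (s * (Pi.single j 1 : Fin n → ℝ) j)))
      simp only [matchedPlant] at h h3 ⊢
      linarith
    · have hv : totalInput (matchedPlant M' (Pi.single j 1)) (Γ M') 0 l = -(s / ε) := by
        have hsum : ∑ q, impulse (Γ M' l q) 0 * (Pi.single j 1 : Fin n → ℝ) q =
            impulse (Γ M' l j) 0 := by simp [Pi.single_apply]
        rw [totalInput_zero]
        simp only [matchedPlant]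
        rw [hsum, hoff M' l j hls hne.symm, impulse_strategyTheta hε, if_pos rfl, thetaFeed,
          probeModel_A_target M hil s hne, probeModel_B_of_ne M hil s hne,
          probeModel_D_of_ne M hil s hne, nodeGain_of_not_isSink _ hls]
        simp
        field_simp
      simp only [matchedPlant] at hv
      rw [hv, nodeGain_of_not_isSink _ hls, Pi.single_eq_same]
      refine le_of_eq ?_
      field_simp
      ring

/-- A strategy that is nowhere worse than `Γ^Θ` starts with the same input. -/
lemma totalInput_zero_eq_of_le (hε : 0 < ε) {Γ : Strategy GP ε}
    (hdom : ∀ P : Plant GP ε, cost P (Γ P.model) ≤ cost P (strategyTheta GP ε P.model))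
    (M : PlantModel GP ε) (hK : AgreesNonsink M (Γ M)) (x0 w0 : Fin n → ℝ) (i : Fin n) :
    totalInput ⟨M, x0, w0⟩ (Γ M) 0 i = totalInput ⟨M, x0, w0⟩ (strategyTheta GP ε M) 0 i := by
  rw [totalInput_zero, totalInput_zero]
  congr 1
  by_cases hi : IsSink GP i
  swap
  · exact Finset.sum_congr rfl fun l _ => by rw [hK i hi 1 0 Nat.zero_lt_one l]
  -- The disturbance enters both inputs additively, so equality for the matched disturbance gives
  -- equality for every `w0`.
  set P := matchedPlant M x0 with hP
  have h := (le_cost_of_agreesNonsink hε P (Γ M) hK).trans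
    ((hdom P).trans (cost_matchedPlant_le hε M x0))
  rw [ENNReal.ofReal_le_ofReal_iff (thetaValue_nonneg _ _),
    stageCost_add_thetaValue hε P (Γ M) hK 0 fun _ _ => rfl, closedLoopState_zero] at h
  have hnn : ∀ q ∈ Finset.univ, 0 ≤ (nodeGain M q)⁻¹ * (totalInput P (Γ M) 0 q -
      (M.B q q)⁻¹ * (nodeGain M q - 1) * M.A.mulVec x0 q) ^ 2 := fun q _ =>
    mul_nonneg (inv_nonneg.2 (nodeGain_nonneg _ _)) (sq_nonneg _)
  have hz := (Finset.sum_eq_zero_iff_of_nonneg hnn).1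
    (le_antisymm (le_of_add_le_add_left (h.trans_eq (add_zero _).symm))
      (Finset.sum_nonneg hnn)) i (Finset.mem_univ i)
  have hv := pow_eq_zero_iff two_ne_zero |>.1
    ((mul_eq_zero.1 hz).resolve_left (inv_ne_zero (nodeGain_pos M hi).ne'))
  have hΘ := totalInput_of_agreesBefore hε P (strategyTheta GP ε M) i 0 fun _ _ _ => rfl
  have hΘ' : totalInput P (strategyTheta GP ε M) 0 i =
      (M.B i i)⁻¹ * (nodeGain M i - 1) * M.A.mulVec x0 i := by
    rw [hΘ]
    simp [hP, matchedPlant]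
  have := (sub_eq_zero.1 hv).trans hΘ'.symm
  rw [totalInput_zero, totalInput_zero] at this
  exact add_right_cancel this

/-- Equal first inputs give equal first stages and equal states at time one; from there `thetaValue`
bounds the cost of `Γ` from below and that of `Γ^Θ` from above. -/
lemma cost_strategyTheta_le_of_le (hε : 0 < ε) (hC : TotallyDisconnectedGraph GC)
    {Γ : Strategy GP ε}
    (hΓ : Γ ∈ strategies GP GK GC ε) (hΘ : strategyTheta GP ε ∈ strategies GP GK GC ε)
    (hdom : ∀ P : Plant GP ε, cost P (Γ P.model) ≤ cost P (strategyTheta GP ε P.model))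
    (P : Plant GP ε) : cost P (strategyTheta GP ε P.model) ≤ cost P (Γ P.model) := by
  have hK := agreesNonsink_of_le hε hC hΓ hΘ hdom P.model
  have hv : ∀ i, totalInput P (Γ P.model) 0 i =
      totalInput P (strategyTheta GP ε P.model) 0 i :=
    totalInput_zero_eq_of_le hε hdom P.model hK P.x0 P.w0
  have hx : closedLoopState P (Γ P.model) 1 =
      closedLoopState P (strategyTheta GP ε P.model) 1 := by
    ext i
    rw [closedLoopState_succ, closedLoopState_succ, hv, closedLoopState_zero, closedLoopState_zero]
  have hs : stageCost P (Γ P.model) 0 = stageCost P (strategyTheta GP ε P.model) 0 := by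
    simp only [stageCost, hv, closedLoopState_zero]
  refine (cost_strategyTheta_le hε P).trans ?_
  rw [← hx, ← hs]
  exact le_cost_of_agreesNonsink hε P _ hK

end
end LimitedModel
open LimitedModel
theorem mainTheorem2 {n : ℕ} (GP GK GC : Digraph (Fin n)) (εb : ℝ) (hεb : 0 < εb)
    (hKloops : HasAllLoops GK) (hCloops : HasAllLoops GC)
    (hisolated : ∀ i, ¬ IsIsolated GP i) (hsink : ∃ i, IsSink GP i)
    (hC : TotallyDisconnectedGraph GC) (hPK : GP ≤ GK) :
    (¬ (nonsinkBlock GP).IsDiag → ∀ Γ ∈ strategies GP GK GC εb,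
      ENNReal.ofReal ((2 * εb ^ 2 + 1 + √(4 * εb ^ 2 + 1)) / (2 * εb ^ 2)) ≤
          competitiveRatio GK Γ ∧
        ENNReal.ofReal ((2 * εb ^ 2 + 1 + √(4 * εb ^ 2 + 1)) / (2 * εb ^ 2)) ≤
          blindCompetitiveRatio GK Γ) ∧
    IsUndominated (strategies GP GK GC εb) (strategyTheta GP εb) := by
  refine ⟨fun hdiag Γ hΓ => ?_, ?_⟩
  -- The nonzero entry is an edge `j → i` between nonsinks; as `i` is not a sink, an edge `i → l`
  -- continues it.
  · obtain ⟨i, j, hij, hne⟩ : ∃ i j : {i : Fin n // ¬ IsSink GP i}, i ≠ j ∧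
        nonsinkBlock GP i j ≠ 0 := by
      by_contra! h
      exact hdiag fun i j hij => h i j hij
    have hji : GP.Adj j i := by
      by_contra h
      simp [nonsinkBlock, adjacency, h] at hne
    obtain ⟨l, hl, hil⟩ := exists_adj_of_not_isSink i.2
    exact ⟨le_competitiveRatio hεb hKloops Γ i _ (by positivity),
      le_blindCompetitiveRatio hεb hC hPK hΓ hji hil (fun h => hij (Subtype.ext h.symm)) hl.symm⟩
  · have hΘ := strategyTheta_mem (GK := GK) (GC := GC) hεb hKloops hCloops hPK
    refine ⟨hΘ, ?_⟩
    rintro ⟨Γ, hΓ, hdom, P, hP⟩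
    exact hP.not_ge (cost_strategyTheta_le_of_le hεb hC hΓ hΘ hdom P)
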